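/- Let $p\ge 1$, $\omega=e^{2\pi i/p}$, $\zeta=\lambda^p$. A background is a sequence $b=(b_n)_{n\ge1}$ of complex numbers, almost all zero. A state $|\Phi\rangle$ (charge zero, not necessarily decomposable) is given, around $b$ and for string coupling $g\neq0$, by the formal power series $Z(j)=\langle b/g|e^{\sum_{n\ge1} j_n\alpha_n}|\Phi\rangle$, $Z(0)\ne0$, on which $\alpha_n=\partial/\partial j_n$, $\alpha_{-n}=n(b_n/g+j_n)$ $(n\ge1)$, $\alpha_0=0$. Write $\langle\mathcal A\rangle_b=\langle b/g|\mathcal A|\Phi\rangle/\langle b/g|\Phi\rangle$. Put $\partial\varphi_a(\zeta)=\frac1p\sum_{n\in\mathbb Z}\omega^{-na}\alpha_n\zeta^{-n/p-1}$ and $W^s(\zeta)=\sum_{a=0}^{p-1}:\!e^{-\varphi_a}\partial_\zeta^s e^{\varphi_a}\!:\;=\sum_n W^s_n\zeta^{-n-s}$, normal ordered on the $\zeta$-plane. Assume the $W_{1+\infty}$ constraints $W^s_n|\Phi\rangle=0$ for all $s\ge1$, $n\ge -s+1$. Let $[\cdot]_{\rm pol}$ be the part of a series in $\zeta^{1/p}$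 containing only nonnegative integer powers of $\zeta$, and let $a_1^b(\zeta)=p\bigl[\frac1p\sum_n n b_n\zeta^{n/p-1}\bigr]_{\rm pol}=\sum_{n\ge1}np\,b_{np}\,\zeta^{n-1}$. Let $b'$ be any background with $b'_n=b_n$ whenever $p\nmid n$ (a finite perturbation of $b$ by the operators $\mathcal O_{np}$), and put $\delta=\frac1p(a_1^b-a_1^{b'})\in\mathbb C[\zeta]$. 1. (Finite $g$.) The expansion of $|\Phi\rangle$ around $b'$, given by $\langle b'/g|=\langle b/g|e^{\frac1g\sum_n(b'_n-b_n)\alpha_n}$, exists, satisfies $\langle b'/g|\Phi\rangle\neq0$ and the $W_{1+\infty}$ constraints in the background $b'$, and for all $s\ge1$ $$\langle W^s(\zeta)\rangle_{b'}=\Bigl\langle\sum_{a=0}^{p-1}:\!e^{-(\varphi_a-\frac1g\int^\zeta\delta)}\,\partial_\zeta^s\,e^{\varphi_a-\frac1g\int^\zeta\delta}\!:\Bigr\rangle_{b}.$$ 2. (Weak coupling.) Consider such states for small real $g>0$, and assume that their connected correlation functions in the background $b$ have the leading genus behaviour: every $g^{2-N}\langle\mathcal O_{n_1}\cdots\mathcal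 O_{n_N}\rangle_{\rm c}$ $(N\ge1)$ has a limit as $g\to0^+$. Then the same holds in the background $b'$; the disk amplitudes $Q_0=\lim_{g\to0^+} g\langle\partial\varphi_0(\zeta)\rangle_b$ and $Q_0'=\lim_{g\to0^+} g\langle\partial\varphi_0(\zeta)\rangle_{b'}$ exist coefficientwise. Write $Q_a(\zeta)=Q_0(e^{2\pi ia}\zeta)$, $Q_a'(\zeta)=Q_0'(e^{2\pi ia}\zeta)$, $a_s=\frac ps[Q_0^s]_{\rm pol}$, $a_s'=\frac ps[Q_0'^s]_{\rm pol}$ for $s\ge1$. Then $a_1=a_1^b$, $a'_1=a_1^{b'}$, $Q_0'=Q_0-\delta$, and for all $s\ge1$ $$\lim_{g\to0^+}g^s\langle W^s(\zeta)\rangle_{b'}=\sum_{a=0}^{p-1}(Q_a-\delta)^s=\sum_{a=0}^{p-1}Q_a'^s=s\,a'_s(\zeta)=p\,[Q_0'^s]_{\rm pol}.$$ With the Schur polynomials $\exp\bigl(\sum_{s\ge1}x_st^s\bigr)=\sum_k\mathcal S_k(x)t^k$ and the polynomials $F(\zeta,Q)=\sum_{k=0}^pQ^{p-k}\mathcal S_k(-a(\zeta))$,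 $F'(\zeta,Q)=\sum_{k=0}^pQ^{p-k}\mathcal S_k(-a'(\zeta))$ of the algebraic curves of the two backgrounds, $$F(\zeta,Q)=\prod_{a=0}^{p-1}(Q-Q_a)=\prod_{a=0}^{p-1}\bigl((Q-\delta)-Q'_a\bigr)=\sum_{k=0}^p(Q-\delta)^k\mathcal S_{p-k}(-a')=F'(\zeta,Q-\delta).$$ Hence the perturbation does not change the algebraic curve: $(\zeta,Q)\mapsto(\zeta,Q-\delta(\zeta))$ maps $\{F=0\}\subset\mathbb C^2$ onto $\{F'=0\}$, and $Q\mapsto Q+\delta$ defines an isomorphism $\mathbb C[\zeta,Q]/(F)\cong\mathbb C[\zeta,Q]/(F')$ of $\mathbb C[\zeta]$-algebras. 3. One may set $a_1\equiv0$: the background $\bar b$ with $\bar b_{np}=0$ for all $n\ge1$ and $\bar b_n=b_n$ for $p\nmid n$ is an admissible choice of $b'$, and $a_1^{\bar b}=0$, so that then $\delta=a_1/p$. -/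

import Mathlib

open scoped Polynomial LaurentSeries PowerSeries Topology

namespace MinimalString

noncomputable section

/-! ## States and oscillators

A charge-zero fermion state `|Φ⟩` is described, around a background `b = (b_n)`, by its bosonic
representative, the generating function of the microscopic-loop amplitudes
`Z(j) = ⟨b/g| exp(∑ j_n α_n) |Φ⟩`, a formal power series in the variables `j_n` (`n ≥ 1`).
On such series the oscillators act by `α_n = ∂/∂j_n`, `α_{-n} = n (b_n/g + j_n)` (`n ≥ 1`) and
`α_0 = 0`; this is the expansion `x_n/g = b_n/g + j_n` of `α_n = g ∂/∂x_n`,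
`α_{-n} = n x_n/g`. -/

/-- Backgrounds `b = (b_n)_{n ≥ 1}` with finitely many non-zero entries. -/
abbrev Background := ℕ+ →₀ ℂ

/-- The series `Z(j) = ⟨b/g| exp(∑ j_n α_n) |Φ⟩`. -/
abbrev State := MvPowerSeries ℕ+ ℂ

/-- Symbols of normal ordered operators: polynomials in the annihilation modes `α_n`, `n ≥ 1`
(the outer variables), whose coefficients are polynomials in the `j_n` (the inner variables). -/
abbrev Symbol := MvPolynomial ℕ+ (MvPolynomial ℕ+ ℂ)

/-- `∏ (∂/∂j_n)^{l_n}` acting on power series. -/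
def iterDeriv (l : ℕ+ →₀ ℕ) (Z : State) : State :=
  fun m => ((m + l).prod fun n e => (e.descFactorial (l n) : ℂ)) * MvPowerSeries.coeff (m + l) Z

/-- The normal ordered operator with symbol `r`, applied to a state: the derivatives `α_n = ∂/∂j_n`
act first, the multiplications by `j_n` last. -/
def quantize (r : Symbol) (Z : State) : State :=
  ∑ l ∈ r.support, ((MvPolynomial.coeff l r : MvPolynomial ℕ+ ℂ) : State) * iterDeriv l Z

/-- `Z'` is the expansion around the background `b'` of the state whose expansion around `b` is
`Z`: `⟨b'/g| = ⟨b/g| exp(g⁻¹ ∑ (b'_n - b_n) α_n)`, the exponential series converging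
coefficientwise. -/
def IsReexpansion (g : ℂ) (b b' : Background) (Z Z' : State) : Prop :=
  ∀ m : ℕ+ →₀ ℕ,
    HasSum
      (fun r : ℕ => ((r.factorial : ℂ)⁻¹) * MvPowerSeries.coeff m
        ((fun Y : State =>
          (b' - b).sum fun n c => (c / g) • MvPowerSeries.pderiv ℂ n Y)^[r] Z))
      (MvPowerSeries.coeff m Z')

/-! ## Series in `λ⁻¹`

All fields are Laurent series in `X = λ⁻¹` (`HahnSeries.single i 1` is `λ^{-i}`), with
`ζ = λ^p`; they are the expansions in `ζ^{-1/p}` around `ζ = ∞`. -/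

/-- `d/dζ = (λ^{1-p}/p) d/dλ`. -/
def dZeta (p : ℕ) {R : Type*} [CommRing R] [Algebra ℂ R] (f : R⸨X⸩) : R⸨X⸩ :=
  -((p : ℂ)⁻¹ • (HahnSeries.single ((p : ℤ) + 1) (1 : R) * LaurentSeries.derivative R f))

/-- `(1/p) (∑_n n x_n ζ^{n/p-1} + ∑_n y_n ζ^{-n/p-1})`. -/
def modeSeries (p : ℕ) {R : Type*} [CommRing R] [Algebra ℂ R] (x : ℕ+ →₀ R) (y : ℕ+ → R) :
    R⸨X⸩ :=
  (p : ℂ)⁻¹ •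
    ((x.sum fun n c => HahnSeries.single ((p : ℤ) - (n : ℕ)) ((n : ℕ) • c)) +
      HahnSeries.single (p : ℤ) 1 *
        HahnSeries.ofPowerSeries ℤ R
          (PowerSeries.mk fun k => if h : 0 < k then y ⟨k, h⟩ else 0))

/-- A polynomial in `ζ`, as a series in `λ⁻¹`. -/
def ofZeta (p : ℕ) (R : Type*) [CommRing R] [Algebra ℂ R] : ℂ[X] →ₐ[ℂ] R⸨X⸩ :=
  Polynomial.aeval (HahnSeries.single (-(p : ℤ)) (1 : R))

/-- The `a`-th sheet `f_a(ζ) = f_0(e^{2πia} ζ)`, that is, `λ ↦ ω^a λ` with `ω = e^{2πi/p}`. -/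
def sheet (p a : ℕ) {R : Type*} [CommRing R] [Algebra ℂ R] (f : R⸨X⸩) : R⸨X⸩ where
  coeff i := (Complex.exp (2 * Real.pi * Complex.I / p)) ^ (-((a : ℤ) * i)) • f.coeff i
  isPWO_support' := f.isPWO_support.mono fun i hi h => hi (by simp [h])

/-- The polynomial part `[f]_pol = ∑_{l ≥ 0} c_l ζ^l`. -/
def polPart (p : ℕ) (f : ℂ⸨X⸩) : ℂ[X] :=
  ∑ l ∈ Finset.range ((-f.order).toNat + 1), Polynomial.monomial l (f.coeff (-((p : ℤ) * l)))

/-! ## The `W_{1+∞}` currents -/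

/-- The symbol of `∂φ_0(ζ) = (1/p) ∑_n α_n ζ^{-n/p-1}` under `⟨b/g| exp(∑_{n ∈ S} j_n α_n)`: the
creation modes are the numbers `α_{-n} = n (b_n/g + j_n)`, where only the `j_n` with `n ∈ S` are
kept and the other ones are set to `0`. -/
def dphi (p : ℕ) (g : ℂ) (b : Background) (S : Finset ℕ+) : Symbol⸨X⸩ :=
  modeSeries p
    (b.mapRange (fun c => algebraMap ℂ Symbol (c / g)) (by simp) +
      ∑ n ∈ S, Finsupp.single n (MvPolynomial.C (MvPolynomial.X n)))
    (fun n => MvPolynomial.X n)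

/-- `e^{-φ} ∂_ζ^s e^{φ} = (∂_ζ + J)^s 1` with `J = ∂φ`, in the commutative algebra of symbols
(normal ordering in the oscillators `α_n`). -/
def oscNormal (p : ℕ) (J : Symbol⸨X⸩) (s : ℕ) : Symbol⸨X⸩ :=
  (fun f => dZeta p f + J * f)^[s] 1

/-- The ratio between `:e^{φ_0(ζ')-φ_0(ζ)}:`, normal ordered on the `ζ`-plane, and the same
exponential normal ordered in the oscillators (on the `λ`-plane):
`(dλ'/dζ')^{1/2} (dλ/dζ)^{1/2} (ζ'-ζ)/(λ'-λ)
  = (1+u)^{(1-p)/(2p)} (u/p) / ((1+u)^{1/p} - 1)`, for `ζ' = ζ (1+u)`.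
It is the exponential of one half of the double integral of
`N_2 = ∂_{ζ₁}∂_{ζ₂} [ln(ζ₁^{1/p} - ζ₂^{1/p}) - ln(ζ₁ - ζ₂)]` over `[ζ, ζ']²`. -/
def orderingFactor (p : ℕ) : ℂ⟦X⟧ :=
  PowerSeries.binomialSeries ℂ ((1 - (p : ℂ)) / (2 * p)) *
    (PowerSeries.mk fun n => (p : ℂ) * Ring.choose ((p : ℂ)⁻¹) (n + 1))⁻¹

/-- `:e^{-φ_0(ζ)} ∂^s e^{φ_0(ζ)}:`, normal ordered on the `ζ`-plane, for `∂φ_0 = J`: the `s`-th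
derivative of `:e^{φ_0(ζ')-φ_0(ζ)}:` with respect to `ζ'` at `ζ' = ζ`. -/
def wSheet (p : ℕ) (J : Symbol⸨X⸩) (s : ℕ) : Symbol⸨X⸩ :=
  ∑ k ∈ Finset.range (s + 1),
    ((s.choose k : ℂ) * ((s - k).factorial : ℂ) *
        PowerSeries.coeff (s - k) (orderingFactor p)) •
      (HahnSeries.single ((p : ℤ) * ((s - k : ℕ) : ℤ)) 1 * oscNormal p J k)

/-- `W^s(ζ) = ∑_a :e^{-φ_a(ζ)} ∂^s e^{φ_a(ζ)}:`, for `∂φ_0 = J`. -/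
def wCurrent (p : ℕ) (J : Symbol⸨X⸩) (s : ℕ) : Symbol⸨X⸩ :=
  ∑ a ∈ Finset.range p, sheet p a (wSheet p J s)

/-- `W^s_n |Φ⟩`, where `W^s(ζ) = ∑_n W^s_n ζ^{-n-s}`. The variables `j_n` that do not occur in a
monomial do not contribute to its coefficient. -/
def wMode (p : ℕ) (g : ℂ) (b : Background) (s : ℕ) (n : ℤ) (Z : State) : State :=
  fun m => MvPowerSeries.coeff m
    (quantize ((wCurrent p (dphi p g b m.support) s).coeff ((p : ℤ) * (n + s))) Z)

/-- The `W_{1+∞}` constraints `W^s_n |Φ⟩ = 0` for `s ≥ 1`, `n ≥ -s + 1`. -/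
def WConstraints (p : ℕ) (g : ℂ) (b : Background) (Z : State) : Prop :=
  ∀ s : ℕ, 1 ≤ s → ∀ n : ℤ, -(s : ℤ) + 1 ≤ n → wMode p g b s n Z = 0

/-- The coefficient of `λ^{-i}` in `⟨b/g| O(ζ) |Φ⟩ / ⟨b/g|Φ⟩`. -/
def vev (Z : State) (O : Symbol⸨X⸩) (i : ℤ) : ℂ :=
  MvPowerSeries.constantCoeff (quantize (O.coeff i) Z) / MvPowerSeries.constantCoeff Z

/-! ## The weak coupling limit -/

/-- The generating function `ln (Z(j) / Z(0))` of connected correlation functions. -/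
def freeEnergy (Z : State) : State :=
  (PowerSeries.log ℂ).subst
    (MvPowerSeries.C ((MvPowerSeries.constantCoeff Z)⁻¹) * Z - 1 : State)

/-- The connected correlation function `⟨∏ O_n^{m_n}⟩_c`. -/
def connected (Z : State) (m : ℕ+ →₀ ℕ) : ℂ :=
  (m.prod fun _ e => (e.factorial : ℂ)) * MvPowerSeries.coeff m (freeEnergy Z)

/-- Leading order of the genus expansion
`⟨O_{n_1} ⋯ O_{n_N}⟩_c = ∑_{h ≥ 0} g^{2h+N-2} ⟨O_{n_1} ⋯ O_{n_N}⟩_c^{(h)}`, as `g → 0+`: every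
`g^{2-N} ⟨O_{n_1} ⋯ O_{n_N}⟩_c` with `N ≥ 1` has a limit. -/
def HasPlanarLimit (Z : ℝ → State) : Prop :=
  ∀ m : ℕ+ →₀ ℕ, m ≠ 0 → ∃ c : ℂ,
    Filter.Tendsto (fun g : ℝ => (g : ℂ) ^ (2 - (m.degree : ℤ)) * connected (Z g) m)
      (𝓝[>] 0) (𝓝 c)

/-- `Q` is the disk amplitude `Q_0(ζ) = ⟨∂φ_0(ζ)⟩^{(0)} = lim_{g → 0+} g ⟨∂φ_0(ζ)⟩`
(limit of every coefficient). -/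
def IsDiskAmplitude (p : ℕ) (b : Background) (Z : ℝ → State) (Q : ℂ⸨X⸩) : Prop :=
  ∀ i : ℤ, Filter.Tendsto (fun g : ℝ => (g : ℂ) * vev (Z g) (dphi p g b ∅) i)
    (𝓝[>] 0) (𝓝 (Q.coeff i))

/-- `a_s(ζ) = (p/s) [Q_0(ζ)^s]_pol`, for `s ≥ 1`. -/
def aPoly (p : ℕ) (Q : ℂ⸨X⸩) (s : ℕ) : ℂ[X] :=
  ((p : ℂ) / s) • polPart p (Q ^ s)

/-- `a_1(ζ) = p [Q_0(ζ)]_pol` in terms of the background: only the part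
`N_1(ζ) = (1/p) ∑_n n b_n ζ^{n/p-1}` of the disk amplitude contributes to it. -/
def aOne (p : ℕ) (b : Background) : ℂ[X] :=
  (p : ℂ) • polPart p (modeSeries p b 0)

/-- `(a_1(ζ) - a_1'(ζ)) / p` for two backgrounds. -/
def shift (p : ℕ) (b b' : Background) : ℂ[X] :=
  (p : ℂ)⁻¹ • (aOne p b - aOne p b')

/-- The Schur polynomials, `exp(∑_{s ≥ 1} x_s t^s) = ∑_k S_k(x) t^k`. -/
def schur (x : ℕ → ℂ[X]) (k : ℕ) : ℂ[X] :=
  PowerSeries.coeff k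
    ((PowerSeries.exp ℂ).subst (PowerSeries.mk fun s => if s = 0 then 0 else x s : ℂ[X]⟦X⟧))

/-- The polynomial `F(ζ,Q) = ∑_{k=0}^p S_k(-a(ζ)) Q^{p-k}` of the algebraic curve `F = 0`, as a
polynomial in `Q` over `ℂ[ζ]`. -/
def curve (p : ℕ) (Q : ℂ⸨X⸩) : ℂ[X][X] :=
  ∑ k ∈ Finset.range (p + 1),
    Polynomial.C (schur (fun s => -aPoly p Q s) k) * Polynomial.X ^ (p - k)

end

end MinimalString

namespace MinimalString

/-! ### Laurent series -/

/-! The sum over sheets in `W^1` keeps only the modes `α_{kp}`, so the constraint for `s = 1` says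
that every `∂/∂j_{kp}` kills `Z` (`WConstraints.pderiv_eq_zero`). The exponential that moves `b` to
`b'` is built from these derivatives alone, hence acts as the identity: `Z' = Z`
(`WConstraints.eq_of_reexpansion`). All that changes is the numerical part of the creation modes
`α_{-kp}`, so `∂φ_0` is shifted by `-δ/g` with `δ` a polynomial in `ζ` (`dphi_eq_sub`). This is the
finite-coupling formula. The constraints survive because a shift by a polynomial `d` mixes `W^s`
with the `W^k`, `k ≤ s`, with coefficients in `ℂ[ζ]` (`wCurrent_sub`), and multiplication by such
coefficients creates no new negative powers of `ζ` from nonnegative ones (`constraints_sub`).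

At weak coupling, `Z ∂F = ∂Z` and the genus bound make the rescaled correlation functions factorize
into one-point functions (`tendsto_coeff_state`). Treating the coupling as a formal variable, the
limit of `g^s W^s` is an evaluation at coupling `0`, where derivative and ordering terms disappear
and `∑_a Q_a^s` remains (`tendsto_vev_wCurrent`). The constraints then make all power sums of the
`Q_a` polynomials in `ζ` (`sum_sheet_pow_eq`). Newton's identities identify the Schur polynomials
with the signed elementary symmetric functions, so `F = ∏ (Q - Q_a)` (`curve_map_eq_prod`). Since
`δ` is the same on all sheets, `Q'_a = Q_a - δ`, and the two products differ by the substitution `Q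
↦ Q - δ` (`curve_eq_comp`). -/

theorem coeff_mul_of_support_subset {R : Type*} [CommRing R] {x y : R⸨X⸩} {s t : Set ℤ}
    (hs : s.IsPWO) (ht : t.IsPWO) (hx : x.support ⊆ s) (hy : y.support ⊆ t) (i : ℤ) :
    (x * y).coeff i =
      ∑ ij ∈ Finset.antidiagonal hs ht i, x.coeff ij.1 * y.coeff ij.2 := by
  rw [HahnSeries.coeff_mul]
  refine Finset.sum_subset (fun ij h => ?_) (fun ij h h' => ?_)
  · simp only [Finset.mem_antidiagonal] at h ⊢
    exact ⟨hx h.1, hy h.2.1, h.2.2⟩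
  · simp only [Finset.mem_antidiagonal] at h h'
    by_contra hne
    exact h' ⟨fun h0 => hne (by simp [h0]), fun h0 => hne (by simp [h0]), h.2.2⟩

/-- The coefficientwise action of a ring homomorphism on Laurent series. -/
noncomputable def mapCoeff {R S : Type*} [CommRing R] [CommRing S] (φ : R →+* S) :
    R⸨X⸩ →+* S⸨X⸩ where
  toFun f := f.map φ
  map_one' := HahnSeries.map_one φ.toMonoidWithZeroHom
  map_zero' := by ext; simp
  map_add' f g := by ext; simp
  map_mul' f g := HahnSeries.map_mul (φ : R →ₙ+* S)

@[simp]
theorem mapCoeff_coeff {R S : Type*} [CommRing R] [CommRing S] (φ : R →+* S) (f : R⸨X⸩) (i : ℤ) :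
    (mapCoeff φ f).coeff i = φ (f.coeff i) := rfl

@[simp]
theorem mapCoeff_single {R S : Type*} [CommRing R] [CommRing S] (φ : R →+* S) (i : ℤ) (r : R) :
    mapCoeff φ (HahnSeries.single i r) = HahnSeries.single i (φ r) := by
  ext j
  by_cases h : j = i
  · subst h; simp
  · simp [h]

section
variable {R : Type*} [CommRing R] [Algebra ℂ R] (p : ℕ)

theorem smul_eq_C_mul (c : ℂ) (f : R⸨X⸩) : c • f = HahnSeries.C (algebraMap ℂ R c) * f := by
  ext i
  rw [HahnSeries.C_apply, HahnSeries.coeff_single_mul, sub_zero, ← Algebra.smul_def,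
    HahnSeries.coeff_smul]

theorem exp_zpow_add (a : ℕ) (i j : ℤ) :
    (Complex.exp (2 * Real.pi * Complex.I / p)) ^ (-((a : ℤ) * (i + j))) =
      (Complex.exp (2 * Real.pi * Complex.I / p)) ^ (-((a : ℤ) * i)) *
        (Complex.exp (2 * Real.pi * Complex.I / p)) ^ (-((a : ℤ) * j)) := by
  rw [← zpow_add₀ (Complex.exp_ne_zero _)]
  congr 1
  ring

theorem sheet_coeff (a : ℕ) (f : R⸨X⸩) (i : ℤ) :
    (sheet p a f).coeff i =
      (Complex.exp (2 * Real.pi * Complex.I / p)) ^ (-((a : ℤ) * i)) • f.coeff i := rfl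

theorem support_sheet_subset (a : ℕ) (f : R⸨X⸩) : (sheet p a f).support ⊆ f.support :=
  fun i hi h => hi (by simp [sheet_coeff, h])

/-- The passage to the `a`-th sheet as a ring homomorphism. -/
noncomputable def sheetHom (a : ℕ) : R⸨X⸩ →+* R⸨X⸩ where
  toFun := sheet p a
  map_one' := by
    ext i
    by_cases h : i = 0
    · subst h; simp [sheet_coeff]
    · simp [sheet_coeff, HahnSeries.coeff_one, h]
  map_zero' := by ext; simp [sheet_coeff]
  map_add' f g := by ext; simp [sheet_coeff]
  map_mul' f g := by
    ext i
    rw [coeff_mul_of_support_subset f.isPWO_support g.isPWO_support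
      (support_sheet_subset p a f) (support_sheet_subset p a g), sheet_coeff,
      HahnSeries.coeff_mul, Finset.smul_sum]
    refine Finset.sum_congr rfl fun ij h => ?_
    rw [Finset.mem_antidiagonal] at h
    rw [sheet_coeff, sheet_coeff, ← h.2.2, exp_zpow_add, smul_mul_smul_comm]

@[simp]
theorem sheetHom_apply (a : ℕ) (f : R⸨X⸩) : sheetHom p a f = sheet p a f := rfl

theorem exp_zpow_mul_self (hp : 0 < p) (a : ℕ) (l : ℤ) :
    (Complex.exp (2 * Real.pi * Complex.I / p)) ^ (-((a : ℤ) * (p * l))) = 1 := by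
  have h : (Complex.exp (2 * Real.pi * Complex.I / p)) ^ (p : ℤ) = 1 := by
    rw [zpow_natCast]
    exact (Complex.isPrimitiveRoot_exp p hp.ne').pow_eq_one
  rw [show -((a : ℤ) * (p * l)) = (p : ℤ) * (-(a * l)) by ring, zpow_mul, h, one_zpow]

theorem sum_sheet_coeff_mul (hp : 0 < p) (f : R⸨X⸩) (l : ℤ) :
    (∑ a ∈ Finset.range p, sheet p a f).coeff (p * l) = (p : ℂ) • f.coeff (p * l) := by
  rw [HahnSeries.coeff_sum]
  simp only [sheet_coeff, exp_zpow_mul_self p hp, one_smul, Finset.sum_const, Finset.card_range]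
  exact (Nat.cast_smul_eq_nsmul ℂ _ _).symm

/-- A geometric sum over the `p`-th roots of unity vanishes: summing over sheets projects onto
integer powers of `ζ`. -/
theorem sum_sheet_coeff_of_not_dvd (hp : 0 < p) (f : R⸨X⸩) {i : ℤ} (hi : ¬ (p : ℤ) ∣ i) :
    (∑ a ∈ Finset.range p, sheet p a f).coeff i = 0 := by
  rw [HahnSeries.coeff_sum]
  simp only [sheet_coeff]
  rw [← Finset.sum_smul]
  have hprim := Complex.isPrimitiveRoot_exp p hp.ne'
  set w := Complex.exp (2 * Real.pi * Complex.I / p)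
  have h1 : w ^ (-i) ≠ 1 := fun h => hi <| by
    have := (hprim.zpow_eq_one_iff_dvd (-i)).1 h
    exact (dvd_neg).1 this
  have h2 : ∑ a ∈ Finset.range p, w ^ (-((a : ℤ) * i)) = 0 := by
    have h3 : ∀ a ∈ Finset.range p, w ^ (-((a : ℤ) * i)) = (w ^ (-i)) ^ a := fun a _ => by
      rw [← zpow_natCast, ← zpow_mul]
      congr 1
      ring
    rw [Finset.sum_congr rfl h3, geom_sum_eq h1, ← zpow_natCast, ← zpow_mul, mul_comm, zpow_mul,
      zpow_natCast, hprim.pow_eq_one, one_zpow, sub_self, zero_div]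
  rw [h2, zero_smul]

theorem sheet_mapCoeff {S : Type*} [CommRing S] [Algebra ℂ S] (φ : R →ₐ[ℂ] S) (a : ℕ)
    (f : R⸨X⸩) : sheet p a (mapCoeff (φ : R →+* S) f) = mapCoeff (φ : R →+* S) (sheet p a f) := by
  ext i
  simp [sheet_coeff]

/-! ### The derivation `d/dζ` -/

theorem dZeta_coeff (f : R⸨X⸩) (i : ℤ) :
    (dZeta p f).coeff i = -((p : ℂ)⁻¹ • ((i - p) • f.coeff (i - p))) := by
  simp only [dZeta, HahnSeries.coeff_neg, HahnSeries.coeff_smul, HahnSeries.coeff_single_mul,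
    one_mul, LaurentSeries.derivative_apply, LaurentSeries.hasseDeriv_coeff]
  have h : i - ((p : ℤ) + 1) + ((1 : ℕ) : ℤ) = i - p := by push_cast; ring
  rw [h, Ring.choose_one_right]

theorem dZeta_add (f g : R⸨X⸩) : dZeta p (f + g) = dZeta p f + dZeta p g := by
  ext i
  simp only [dZeta_coeff, HahnSeries.coeff_add, smul_add]
  abel

theorem dZeta_smul (c : ℂ) (f : R⸨X⸩) : dZeta p (c • f) = c • dZeta p f := by
  ext i
  simp only [dZeta_coeff, HahnSeries.coeff_smul, smul_neg]
  rw [smul_comm c, smul_comm c]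

/-- `d/dζ` as a linear map. -/
noncomputable def dZetaₗ : R⸨X⸩ →ₗ[ℂ] R⸨X⸩ where
  toFun := dZeta p
  map_add' := dZeta_add p
  map_smul' := dZeta_smul p

@[simp] theorem dZetaₗ_apply (f : R⸨X⸩) : dZetaₗ p f = dZeta p f := rfl

theorem dZeta_mul (f g : R⸨X⸩) : dZeta p (f * g) = dZeta p f * g + f * dZeta p g := by
  -- Up to the factor `-λ^{-p}/p`, `d/dζ` is the Euler operator that multiplies the coefficient of
  -- index `i` by `i`. The Leibniz rule is then additivity of the index on antidiagonals.
  have key : ∀ x : R⸨X⸩, ∃ y : R⸨X⸩, y.support ⊆ x.support ∧ (∀ i, y.coeff i = i • x.coeff i) ∧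
      dZeta p x = -((p : ℂ)⁻¹ • (HahnSeries.single (p : ℤ) 1 * y)) := fun x => by
    have hy : ∀ i, (HahnSeries.single (1 : ℤ) (1 : R) * LaurentSeries.derivative R x).coeff i =
        i • x.coeff i := fun i => by
      simp [HahnSeries.coeff_single_mul]
    refine ⟨HahnSeries.single (1 : ℤ) (1 : R) * LaurentSeries.derivative R x,
      fun i hi h0 => hi (by rw [hy, h0, smul_zero]), hy, ?_⟩
    rw [← mul_assoc, HahnSeries.single_mul_single, mul_one, dZeta]
  obtain ⟨f', hf, hf', ef⟩ := key f
  obtain ⟨g', hg, hg', eg⟩ := key g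
  obtain ⟨k, -, hk', ek⟩ := key (f * g)
  have h : k = f' * g + f * g' := by
    ext i
    rw [hk', HahnSeries.coeff_add, HahnSeries.coeff_mul,
      coeff_mul_of_support_subset f.isPWO_support g.isPWO_support hf subset_rfl,
      coeff_mul_of_support_subset f.isPWO_support g.isPWO_support subset_rfl hg,
      Finset.smul_sum, ← Finset.sum_add_distrib]
    refine Finset.sum_congr rfl fun ij h => ?_
    rw [Finset.mem_antidiagonal] at h
    rw [hf', hg', ← h.2.2, add_smul, smul_mul_assoc, mul_smul_comm]
  rw [ef, eg, ek, h]
  simp only [smul_eq_C_mul]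
  ring

theorem dZeta_mapCoeff {S : Type*} [CommRing S] [Algebra ℂ S] (φ : R →ₐ[ℂ] S) (f : R⸨X⸩) :
    dZeta p (mapCoeff (φ : R →+* S) f) = mapCoeff (φ : R →+* S) (dZeta p f) := by
  ext i
  simp [dZeta_coeff]

/-! ### Polynomials in `ζ` -/

theorem ofZeta_monomial (l : ℕ) (c : ℂ) :
    ofZeta p R (Polynomial.monomial l c) =
      HahnSeries.single (-((p : ℤ) * l)) (algebraMap ℂ R c) := by
  rw [ofZeta, Polynomial.aeval_monomial, HahnSeries.algebraMap_apply', PowerSeries.algebraMap_apply,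
    HahnSeries.ofPowerSeries_C, HahnSeries.single_pow, one_pow, HahnSeries.C_apply,
    HahnSeries.single_mul_single, mul_one, zero_add, show l • -(p : ℤ) = -((p : ℤ) * l) by
      simp [mul_comm]]

theorem ofZeta_eq_sum (f : ℂ[X]) :
    ofZeta p R f = f.sum fun l c => HahnSeries.single (-((p : ℤ) * l)) (algebraMap ℂ R c) := by
  conv_lhs => rw [f.as_sum_support, map_sum]
  simp only [ofZeta_monomial, Polynomial.sum_def]

theorem ofZeta_coeff_neg_mul (hp : 0 < p) (f : ℂ[X]) (l : ℕ) :
    (ofZeta p R f).coeff (-((p : ℤ) * l)) = algebraMap ℂ R (f.coeff l) := by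
  induction f using Polynomial.induction_on' with
  | add f g hf hg => simp [hf, hg]
  | monomial k c =>
    rw [ofZeta_monomial, Polynomial.coeff_monomial]
    by_cases h : k = l
    · subst h; simp
    · rw [HahnSeries.coeff_single_of_ne, if_neg h, map_zero]
      intro h'
      apply h
      have := mul_left_cancel₀ (by exact_mod_cast hp.ne' : (p : ℤ) ≠ 0) (neg_injective h')
      exact_mod_cast this.symm

theorem ofZeta_coeff_of_ne (f : ℂ[X]) (i : ℤ) (hi : ∀ l : ℕ, i ≠ -((p : ℤ) * l)) :
    (ofZeta p R f).coeff i = 0 := by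
  induction f using Polynomial.induction_on' with
  | add f g hf hg => simp [hf, hg]
  | monomial k c => rw [ofZeta_monomial, HahnSeries.coeff_single_of_ne (hi k)]

theorem ofZeta_coeff_of_pos (f : ℂ[X]) (i : ℤ) (hi : 0 < i) : (ofZeta p R f).coeff i = 0 :=
  ofZeta_coeff_of_ne p f i fun l h => by
    have : (0 : ℤ) ≤ p * l := by positivity
    omega

theorem ofZeta_injective (hp : 0 < p) : Function.Injective (ofZeta p ℂ) := fun f g h => by
  ext l
  have := congrArg (fun x : ℂ⸨X⸩ => x.coeff (-((p : ℤ) * l))) h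
  simpa [ofZeta_coeff_neg_mul p hp] using this

/-- Multiplying by `ζ^l` makes the coefficient of index `i` come from index `i + pl`. For `i = pN`
with `N ≥ 1` only indices `pN'` with `N' ≥ 1` are involved, which is why the constraints tolerate
polynomial factors. -/
theorem ofZeta_mul_coeff (f : ℂ[X]) (x : R⸨X⸩) (i : ℤ) :
    (ofZeta p R f * x).coeff i = f.sum fun l c => c • x.coeff (i + p * l) := by
  rw [ofZeta_eq_sum, Polynomial.sum_def, Polynomial.sum_def, Finset.sum_mul, HahnSeries.coeff_sum]
  refine Finset.sum_congr rfl fun l _ => ?_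
  rw [HahnSeries.coeff_single_mul, sub_neg_eq_add, Algebra.smul_def]

theorem sheet_ofZeta (hp : 0 < p) (a : ℕ) (f : ℂ[X]) :
    sheet p a (ofZeta p R f) = ofZeta p R f := by
  ext i
  by_cases h : ∃ l : ℕ, i = -((p : ℤ) * l)
  · obtain ⟨l, rfl⟩ := h
    rw [sheet_coeff, show -((p : ℤ) * l) = p * (-l) by ring, exp_zpow_mul_self p hp, one_smul]
  · push Not at h
    rw [sheet_coeff, ofZeta_coeff_of_ne p f i h, smul_zero]

theorem dZeta_ofZeta (hp : 0 < p) (f : ℂ[X]) :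
    dZeta p (ofZeta p R f) = ofZeta p R (Polynomial.derivative f) := by
  induction f using Polynomial.induction_on' with
  | add f g hf hg => simp [hf, hg, dZeta_add]
  | monomial l c =>
    rw [Polynomial.derivative_monomial, ofZeta_monomial, ofZeta_monomial]
    have hp0 : (p : ℂ) ≠ 0 := by exact_mod_cast hp.ne'
    ext i
    rw [dZeta_coeff]
    rcases Nat.eq_zero_or_pos l with rfl | hl
    · simp only [Nat.cast_zero, mul_zero, neg_zero, map_zero, HahnSeries.coeff_zero]
      by_cases h : i - p = 0
      · simp [h]
      · rw [HahnSeries.coeff_single_of_ne h]; simp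
    · by_cases h : i - p = -((p : ℤ) * l)
      · have h' : i = -((p : ℤ) * ((l - 1 : ℕ) : ℤ)) := by
          push_cast [hl]
          linarith [h]
        rw [h, HahnSeries.coeff_single_same, h', HahnSeries.coeff_single_same,
          ← Int.cast_smul_eq_zsmul ℂ, smul_smul, ← neg_smul, map_mul, mul_comm (algebraMap ℂ R c),
          ← Algebra.smul_def]
        congr 1
        push_cast
        field_simp
      · rw [HahnSeries.coeff_single_of_ne h, smul_zero, smul_zero, neg_zero,
          HahnSeries.coeff_single_of_ne]
        rintro rfl
        apply h
        push_cast [hl]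
        ring

theorem polPart_coeff (hp : 0 < p) (f : ℂ⸨X⸩) (l : ℕ) :
    (polPart p f).coeff l = f.coeff (-((p : ℤ) * l)) := by
  rw [polPart, Polynomial.finsetSum_coeff]
  simp only [Polynomial.coeff_monomial, Finset.sum_ite_eq', Finset.mem_range]
  split_ifs with h
  · rfl
  · symm
    -- The truncation in `polPart` loses nothing: for `l > -order f`, the index `-pl ≤ -l` lies
    -- below the order since `p ≥ 1`.
    by_contra hne
    have h1 := HahnSeries.order_le_of_coeff_ne_zero hne
    have h2 : (l : ℤ) ≤ p * l := le_mul_of_one_le_left (by positivity) (by exact_mod_cast hp)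
    omega

/-! ### Mode expansions -/

/-- The three cases are the zero mode, the creation modes and the annihilation modes of
`modeSeries`. -/
theorem int_trichotomy_modes (i : ℤ) :
    i = p ∨ (∃ n : ℕ+, i = p - (n : ℕ)) ∨ ∃ n : ℕ+, i = p + (n : ℕ) := by
  rcases lt_trichotomy i p with h | h | h
  · refine Or.inr (Or.inl ⟨⟨(p - i).toNat, by omega⟩, ?_⟩)
    simp only [PNat.mk_coe]; omega
  · exact Or.inl h
  · refine Or.inr (Or.inr ⟨⟨(i - p).toNat, by omega⟩, ?_⟩)
    simp only [PNat.mk_coe]; omega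

theorem modeSeries_coeff_creation (x : ℕ+ →₀ R) (y : ℕ+ → R) (n : ℕ+) :
    (modeSeries p x y).coeff (p - (n : ℕ)) = (p : ℂ)⁻¹ • ((n : ℕ) • x n) := by
  have hn := n.pos
  rw [modeSeries, HahnSeries.coeff_smul, HahnSeries.coeff_add, HahnSeries.coeff_single_mul,
    Finsupp.sum, HahnSeries.coeff_sum, Finset.sum_eq_single n]
  · rw [HahnSeries.coeff_single_same, PowerSeries.coeff_coe, if_pos (by omega), mul_zero, add_zero]
  · intro m _ hm
    rw [HahnSeries.coeff_single_of_ne]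
    intro h
    exact hm (PNat.eq (by omega))
  · intro h
    rw [Finsupp.notMem_support_iff.1 h]
    simp

theorem modeSeries_coeff_zero_mode (x : ℕ+ →₀ R) (y : ℕ+ → R) :
    (modeSeries p x y).coeff p = 0 := by
  rw [modeSeries, HahnSeries.coeff_smul, HahnSeries.coeff_add, HahnSeries.coeff_single_mul,
    Finsupp.sum, HahnSeries.coeff_sum, Finset.sum_eq_zero]
  · simp [PowerSeries.coeff_coe]
  · intro m _
    have hm := m.pos
    rw [HahnSeries.coeff_single_of_ne (by omega)]

theorem modeSeries_coeff_annihilation (x : ℕ+ →₀ R) (y : ℕ+ → R) (n : ℕ+) :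
    (modeSeries p x y).coeff (p + (n : ℕ)) = (p : ℂ)⁻¹ • y n := by
  have hn := n.pos
  rw [modeSeries, HahnSeries.coeff_smul, HahnSeries.coeff_add, HahnSeries.coeff_single_mul,
    Finsupp.sum, HahnSeries.coeff_sum, Finset.sum_eq_zero]
  · rw [add_sub_cancel_left, PowerSeries.coeff_coe, if_neg (by omega), one_mul, zero_add,
      PowerSeries.coeff_mk, dif_pos (by omega)]
    rfl
  · intro m _
    have hm := m.pos
    rw [HahnSeries.coeff_single_of_ne (by omega)]

theorem modeSeries_mapCoeff {S : Type*} [CommRing S] [Algebra ℂ S] (φ : R →ₐ[ℂ] S)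
    (x : ℕ+ →₀ R) (y : ℕ+ → R) (x' : ℕ+ →₀ S) (y' : ℕ+ → S) (c : ℂ) (hx : ∀ n, φ (x n) = c • x' n)
    (hy : ∀ n, φ (y n) = c • y' n) :
    mapCoeff (φ : R →+* S) (modeSeries p x y) = c • modeSeries p x' y' := by
  ext i
  rw [mapCoeff_coeff, HahnSeries.coeff_smul]
  rcases int_trichotomy_modes p i with rfl | ⟨n, rfl⟩ | ⟨n, rfl⟩
  · rw [modeSeries_coeff_zero_mode, modeSeries_coeff_zero_mode, map_zero, smul_zero]
  · rw [modeSeries_coeff_creation, modeSeries_coeff_creation]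
    simp only [RingHom.coe_coe, map_smul, map_nsmul, hx]
    rw [smul_comm c, smul_comm c]
  · rw [modeSeries_coeff_annihilation, modeSeries_coeff_annihilation]
    simp only [RingHom.coe_coe, map_smul, hy]
    rw [smul_comm c]

end

/-! ### Binomial convolution -/

section
variable {A : Type*} [CommRing A]

/-- The product of two sequences that corresponds to the product of their exponential generating
functions. -/
def binomConv (a b : ℕ → A) (n : ℕ) : A :=
  ∑ ij ∈ Finset.HasAntidiagonal.antidiagonal n, (n.choose ij.1 : A) * (a ij.1 * b ij.2)

/-- The exponential generating function of a sequence. -/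
noncomputable def egf [Algebra ℚ A] (a : ℕ → A) : A⟦X⟧ :=
  PowerSeries.mk fun n => algebraMap ℚ A ((n.factorial : ℚ)⁻¹) * a n

theorem egf_binomConv [Algebra ℚ A] (a b : ℕ → A) : egf (binomConv a b) = egf a * egf b := by
  ext n
  rw [PowerSeries.coeff_mul, egf, PowerSeries.coeff_mk, binomConv, Finset.mul_sum]
  refine Finset.sum_congr rfl fun ij h => ?_
  rw [Finset.HasAntidiagonal.mem_antidiagonal] at h
  have hch : (n.factorial : ℚ)⁻¹ * (n.choose ij.1 : ℚ) =
      (ij.1.factorial : ℚ)⁻¹ * (ij.2.factorial : ℚ)⁻¹ := by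
    subst h
    have := Nat.add_choose_mul_factorial_mul_factorial ij.1 ij.2
    have h' : (((ij.1 + ij.2).choose ij.1 : ℕ) : ℚ) * ij.1.factorial * ij.2.factorial =
      ((ij.1 + ij.2).factorial : ℚ) := by
      rw [Nat.choose_symm_add]
      exact_mod_cast this
    rw [← h']
    have h1 : (ij.1.factorial : ℚ) ≠ 0 := by positivity
    have h2 : (ij.2.factorial : ℚ) ≠ 0 := by positivity
    have h3 : (((ij.1 + ij.2).choose ij.1 : ℕ) : ℚ) ≠ 0 := by
      exact_mod_cast (Nat.choose_pos (Nat.le_add_right _ _)).ne'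
    field_simp
  have hA := congrArg (algebraMap ℚ A) hch
  rw [map_mul, map_mul, map_natCast] at hA
  rw [egf, egf, PowerSeries.coeff_mk, PowerSeries.coeff_mk, ← mul_assoc, hA]
  ring

theorem egf_injective [Algebra ℚ A] : Function.Injective (egf : (ℕ → A) → A⟦X⟧) := fun a b h => by
  funext n
  have := congrArg (fun f => algebraMap ℚ A (n.factorial : ℚ) * PowerSeries.coeff n f) h
  have hn : (n.factorial : ℚ) * (n.factorial : ℚ)⁻¹ = 1 :=
    mul_inv_cancel₀ (by positivity)
  simpa only [egf, PowerSeries.coeff_mk, ← mul_assoc, ← map_mul, hn, map_one, one_mul] using this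

/-- Exponential generating functions multiply in a commutative ring. -/
theorem binomConv_left_comm [Algebra ℚ A] (a b c : ℕ → A) :
    binomConv a (binomConv b c) = binomConv b (binomConv a c) :=
  egf_injective (by simp only [egf_binomConv]; ring)

theorem binomConv_succ (a b : ℕ → A) (n : ℕ) :
    binomConv a b (n + 1) =
      binomConv (fun k => a (k + 1)) b n + binomConv a (fun k => b (k + 1)) n := by
  rw [binomConv, Finset.sum_antidiagonal_choose_succ_mul (fun i j => a i * b j), add_comm]
  congr 1
  refine Finset.sum_congr rfl fun ij h => ?_
  rw [Finset.HasAntidiagonal.mem_antidiagonal] at h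
  rw [Nat.choose_symm_of_eq_add h.symm]

end

/-! ### Shifting the currents -/

section
variable (p : ℕ)

theorem oscNormal_succ (J : Symbol⸨X⸩) (s : ℕ) :
    oscNormal p J (s + 1) = dZeta p (oscNormal p J s) + J * oscNormal p J s := by
  rw [oscNormal, Function.iterate_succ_apply']
  rfl

/-- The polynomials `e^D ∂^m e^{-D}` with `∂D = d`. -/
noncomputable def shiftPoly (d : ℂ[X]) (m : ℕ) : ℂ[X] :=
  (fun q => Polynomial.derivative q - d * q)^[m] 1

theorem shiftPoly_succ (d : ℂ[X]) (m : ℕ) :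
    shiftPoly d (m + 1) = Polynomial.derivative (shiftPoly d m) - d * shiftPoly d m := by
  rw [shiftPoly, Function.iterate_succ_apply']
  rfl

/-- Formally `∂ + J - d = e^D (∂ + J) e^{-D}` with `∂D = d`, and the Leibniz rule expands `e^D (∂ +
J)^s e^{-D}`. The induction on `s` needs only the polynomials `e^D ∂^m e^{-D}`, not `e^D` itself. -/
theorem oscNormal_sub (hp : 0 < p) (J : Symbol⸨X⸩) (d : ℂ[X]) :
    oscNormal p (J - ofZeta p Symbol d) =
      binomConv (fun m => ofZeta p Symbol (shiftPoly d m)) (oscNormal p J) := by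
  funext s
  induction s with
  | zero => simp [binomConv, oscNormal, shiftPoly]
  | succ s ih =>
    rw [oscNormal_succ, ih, binomConv_succ, binomConv, binomConv, binomConv, ← dZetaₗ_apply,
      map_sum, Finset.mul_sum, ← Finset.sum_add_distrib, ← Finset.sum_add_distrib]
    refine Finset.sum_congr rfl fun ij _ => ?_
    rw [← nsmul_eq_mul, map_nsmul, dZetaₗ_apply, dZeta_mul, dZeta_ofZeta p hp, oscNormal_succ,
      shiftPoly_succ, map_sub, map_mul]
    simp only [nsmul_eq_mul]
    ring

/-- Changing the normal ordering is itself a binomial convolution, so it commutes with the one that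
shifts `∂φ`. -/
theorem wSheet_eq_binomConv (J : Symbol⸨X⸩) :
    wSheet p J = binomConv
      (fun m => ((m.factorial : ℂ) * PowerSeries.coeff m (orderingFactor p)) •
        HahnSeries.single ((p : ℤ) * (m : ℤ)) 1) (oscNormal p J) := by
  funext s
  rw [wSheet, binomConv, ← Finset.Nat.sum_antidiagonal_swap,
    Finset.Nat.sum_antidiagonal_eq_sum_range_succ_mk]
  refine Finset.sum_congr rfl fun k hk => ?_
  have hk' : k ≤ s := Nat.lt_succ_iff.1 (Finset.mem_range.1 hk)
  simp only [Prod.swap_prod_mk, smul_eq_C_mul, map_mul, map_natCast, Nat.choose_symm hk']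
  ring

theorem wSheet_sub (hp : 0 < p) (J : Symbol⸨X⸩) (d : ℂ[X]) :
    wSheet p (J - ofZeta p Symbol d) =
      binomConv (fun m => ofZeta p Symbol (shiftPoly d m)) (wSheet p J) := by
  rw [wSheet_eq_binomConv, wSheet_eq_binomConv, oscNormal_sub p hp, binomConv_left_comm]

/-- Polynomials in `ζ` are single valued and can be pulled out of the sum over sheets. -/
theorem wCurrent_sub (hp : 0 < p) (J : Symbol⸨X⸩) (d : ℂ[X]) :
    wCurrent p (J - ofZeta p Symbol d) =
      binomConv (fun m => ofZeta p Symbol (shiftPoly d m)) (wCurrent p J) := by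
  funext s
  rw [wCurrent, wSheet_sub p hp, binomConv]
  simp only [binomConv, wCurrent, ← sheetHom_apply, map_sum, map_mul, map_natCast, Finset.mul_sum]
  simp only [sheetHom_apply, sheet_ofZeta p hp]
  exact Finset.sum_comm

theorem wCurrent_zero_coeff_of_pos (J : Symbol⸨X⸩) {i : ℤ} (hi : 0 < i) :
    (wCurrent p J 0).coeff i = 0 := by
  rw [wCurrent, HahnSeries.coeff_sum]
  refine Finset.sum_eq_zero fun a _ => ?_
  simp [sheet_coeff, wSheet, oscNormal, HahnSeries.coeff_one, hi.ne']

/-- Constraints on the nonnegative modes of the currents are stable under a shift of `∂φ` by a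
polynomial in `ζ`. -/
theorem constraints_sub (hp : 0 < p) (J : Symbol⸨X⸩) (d : ℂ[X]) (L : Symbol →ₗ[ℂ] ℂ)
    (h : ∀ s : ℕ, 1 ≤ s → ∀ N : ℤ, 1 ≤ N → L ((wCurrent p J s).coeff (p * N)) = 0)
    (s : ℕ) (N : ℤ) (hN : 1 ≤ N) :
    L ((wCurrent p (J - ofZeta p Symbol d) s).coeff (p * N)) = 0 := by
  have hp' : (0 : ℤ) < p := by exact_mod_cast hp
  -- The convolution also reaches `W^0`, on which the constraints say nothing. It is a constant, so
  -- it has no coefficient of positive index.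
  have h' : ∀ s : ℕ, ∀ N : ℤ, 1 ≤ N → L ((wCurrent p J s).coeff (p * N)) = 0 := fun s N hN => by
    rcases Nat.eq_zero_or_pos s with rfl | hs
    · rw [wCurrent_zero_coeff_of_pos p J (by positivity), map_zero]
    · exact h s hs N hN
  rw [wCurrent_sub p hp, binomConv, HahnSeries.coeff_sum, map_sum]
  refine Finset.sum_eq_zero fun ij _ => ?_
  rw [← nsmul_eq_mul, HahnSeries.coeff_nsmul, Pi.smul_apply, map_nsmul, ofZeta_mul_coeff,
    Polynomial.sum_def, map_sum, Finset.sum_eq_zero, smul_zero]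
  intro l _
  rw [map_smul, ← mul_add, h' _ _ (by omega), smul_zero]

end

/-! ### Quantization -/

theorem quantize_eq_sum {r : Symbol} {T : Finset (ℕ+ →₀ ℕ)} (hT : r.support ⊆ T) (Z : State) :
    quantize r Z = ∑ l ∈ T, ((MvPolynomial.coeff l r : MvPolynomial ℕ+ ℂ) : State) *
      iterDeriv l Z := by
  refine Finset.sum_subset hT fun l _ hl => ?_
  rw [MvPolynomial.notMem_support_iff.1 hl, MvPolynomial.coe_zero, zero_mul]

/-- The action of symbols on a state is linear. -/
noncomputable def quantizeₗ (Z : State) : Symbol →ₗ[ℂ] State where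
  toFun r := quantize r Z
  map_add' r t := by
    classical
    rw [quantize_eq_sum (T := r.support ∪ t.support) MvPolynomial.support_add,
      quantize_eq_sum (T := r.support ∪ t.support) Finset.subset_union_left,
      quantize_eq_sum (T := r.support ∪ t.support) Finset.subset_union_right,
      ← Finset.sum_add_distrib]
    simp only [MvPolynomial.coeff_add, MvPolynomial.coe_add, add_mul]
  map_smul' c r := by
    rw [quantize_eq_sum (T := r.support) MvPolynomial.support_smul, quantize, RingHom.id_apply,
      Finset.smul_sum]
    refine Finset.sum_congr rfl fun l _ => ?_
    rw [MvPolynomial.coeff_smul, MvPolynomial.coe_smul, smul_mul_assoc]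

theorem iterDeriv_coeff (l m : ℕ+ →₀ ℕ) (Z : State) :
    MvPowerSeries.coeff m (iterDeriv l Z) =
      ((m + l).prod fun n e => (e.descFactorial (l n) : ℂ)) * MvPowerSeries.coeff (m + l) Z := rfl

/-! ### Change of the background -/

section
variable (p : ℕ) (b b' : Background)

theorem aOne_coeff (hp : 0 < p) (n : ℕ+) (l : ℕ) (hn : (n : ℕ) = p * (l + 1)) :
    (aOne p b).coeff l = (n : ℕ) * b n := by
  have hp0 : (p : ℂ) ≠ 0 := by exact_mod_cast hp.ne'
  have h : -((p : ℤ) * l) = p - (n : ℕ) := by rw [hn]; push_cast; ring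
  rw [aOne, Polynomial.coeff_smul, polPart_coeff p hp, h, modeSeries_coeff_creation, smul_smul,
    mul_inv_cancel₀ hp0, one_smul, nsmul_eq_mul]

theorem aOne_eq_zero (hp : 0 < p) (h : ∀ n : ℕ+, p ∣ (n : ℕ) → b n = 0) : aOne p b = 0 := by
  ext l
  obtain ⟨n, hn⟩ : ∃ n : ℕ+, (n : ℕ) = p * (l + 1) := ⟨⟨p * (l + 1), by positivity⟩, rfl⟩
  rw [aOne_coeff p b hp n l hn, h n ⟨l + 1, hn⟩, mul_zero, Polynomial.coeff_zero]

/-- Only modes with `p ∣ n` differ, and these are the nonnegative integer powers `ζ^{n/p-1}`. It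
serves for the symbols with `c = 1/g` and for the disk amplitudes with `c = 1`. -/
theorem modeSeries_eq_sub {R : Type*} [CommRing R] [Algebra ℂ R] (hp : 0 < p)
    (hb : ∀ n : ℕ+, ¬ p ∣ (n : ℕ) → b' n = b n) (c : ℂ) (x x' : ℕ+ →₀ R) (y : ℕ+ → R)
    (hx : ∀ n, x' n = x n + algebraMap ℂ R (c * (b' n - b n))) :
    modeSeries p x' y = modeSeries p x y - c • ofZeta p R (shift p b b') := by
  have hp0 : (p : ℂ) ≠ 0 := by exact_mod_cast hp.ne'
  ext i
  rw [HahnSeries.coeff_sub, HahnSeries.coeff_smul]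
  rcases int_trichotomy_modes p i with rfl | ⟨n, rfl⟩ | ⟨n, rfl⟩
  · rw [modeSeries_coeff_zero_mode, modeSeries_coeff_zero_mode,
      ofZeta_coeff_of_pos p _ _ (by exact_mod_cast hp), smul_zero, sub_zero]
  · rw [modeSeries_coeff_creation, modeSeries_coeff_creation, hx]
    by_cases hn : p ∣ (n : ℕ)
    · obtain ⟨k, hk⟩ := hn
      obtain ⟨l, rfl⟩ : ∃ l, k = l + 1 := Nat.exists_eq_succ_of_ne_zero <| by
        rintro rfl
        exact n.pos.ne' (by rw [hk, mul_zero])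
      have h : (p : ℤ) - (n : ℕ) = -((p : ℤ) * l) := by rw [hk]; push_cast; ring
      rw [h, ofZeta_coeff_neg_mul p hp, shift, Polynomial.coeff_smul, Polynomial.coeff_sub,
        aOne_coeff p b hp n l hk, aOne_coeff p b' hp n l hk]
      simp only [nsmul_eq_mul, smul_eq_mul]
      simp only [Algebra.smul_def (R := ℂ) (A := R), map_mul, map_sub, map_natCast]
      ring
    · rw [hb n hn, sub_self, mul_zero, map_zero, add_zero, ofZeta_coeff_of_ne, smul_zero, sub_zero]
      intro l hl
      apply hn
      refine ⟨l + 1, ?_⟩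
      have : ((n : ℕ) : ℤ) = p * (l + 1) := by linarith
      exact_mod_cast this
  · rw [modeSeries_coeff_annihilation, modeSeries_coeff_annihilation,
      ofZeta_coeff_of_pos p _ _ (by positivity), smul_zero, sub_zero]

theorem dphi_eq_sub (hp : 0 < p) (hb : ∀ n : ℕ+, ¬ p ∣ (n : ℕ) → b' n = b n) (g : ℂ)
    (S : Finset ℕ+) :
    dphi p g b' S = dphi p g b S - g⁻¹ • ofZeta p Symbol (shift p b b') := by
  refine modeSeries_eq_sub p b b' hp hb _ _ _ _ fun n => ?_
  rw [Finsupp.add_apply, Finsupp.add_apply, Finsupp.mapRange_apply, Finsupp.mapRange_apply,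
    add_right_comm, ← map_add]
  congr 2
  ring

theorem smul_ofZeta {R : Type*} [CommRing R] [Algebra ℂ R] (hp : 0 < p) (c : ℂ) (d : ℂ[X]) :
    c • ofZeta p R d = ofZeta p R (c • d) := by
  ext i
  rw [HahnSeries.coeff_smul]
  by_cases h : ∃ l : ℕ, i = -((p : ℤ) * l)
  · obtain ⟨l, rfl⟩ := h
    rw [ofZeta_coeff_neg_mul p hp, ofZeta_coeff_neg_mul p hp, Polynomial.coeff_smul, smul_eq_mul,
      map_mul, Algebra.smul_def]
  · push Not at h
    rw [ofZeta_coeff_of_ne p _ i h, ofZeta_coeff_of_ne p _ i h, smul_zero]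

/-- A coefficient of the image of a state, as a linear functional of the symbol. -/
noncomputable def coeffQuantize (m : ℕ+ →₀ ℕ) (Z : State) : Symbol →ₗ[ℂ] ℂ :=
  (MvPowerSeries.coeff m).comp (quantizeₗ Z)

theorem coeffQuantize_apply (m : ℕ+ →₀ ℕ) (Z : State) (r : Symbol) :
    coeffQuantize m Z r = MvPowerSeries.coeff m (quantize r Z) := rfl

theorem coeff_fun (F : (ℕ+ →₀ ℕ) → ℂ) (m : ℕ+ →₀ ℕ) :
    MvPowerSeries.coeff m (F : State) = F m := rfl

theorem coeff_wMode (g : ℂ) (s : ℕ) (n : ℤ) (Z : State) (m : ℕ+ →₀ ℕ) :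
    MvPowerSeries.coeff m (wMode p g b s n Z) =
      coeffQuantize m Z ((wCurrent p (dphi p g b m.support) s).coeff (p * (n + s))) := by
  exact coeff_fun (fun m => MvPowerSeries.coeff m
    (quantize ((wCurrent p (dphi p g b m.support) s).coeff (p * (n + s))) Z)) m

/-- With `N = n + s` the range `n ≥ -s + 1` becomes `N ≥ 1`, uniformly in `s`; this lets currents of
different spin be combined. -/
theorem WConstraints.coeff_eq_zero {g : ℂ} {Z : State} (h : WConstraints p g b Z)
    (m : ℕ+ →₀ ℕ) (s : ℕ) (hs : 1 ≤ s) (N : ℤ) (hN : 1 ≤ N) :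
    coeffQuantize m Z ((wCurrent p (dphi p g b m.support) s).coeff (p * N)) = 0 := by
  have := coeff_wMode p b g s (N - s) Z m
  rwa [h s hs (N - s) (by omega), map_zero, sub_add_cancel, eq_comm] at this

theorem WConstraints.change_background (hp : 0 < p) (hb : ∀ n : ℕ+, ¬ p ∣ (n : ℕ) → b' n = b n)
    {g : ℂ} {Z : State} (h : WConstraints p g b Z) : WConstraints p g b' Z := by
  intro s hs n hn
  refine MvPowerSeries.ext fun m => ?_
  rw [coeff_wMode, dphi_eq_sub p b b' hp hb, smul_ofZeta p hp, map_zero]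
  exact constraints_sub p hp _ _ (coeffQuantize m Z) (h.coeff_eq_zero p b m) s (n + s) (by omega)

end

/-! ### The first current and the expansion around the new background -/

theorem quantize_monomial (l : ℕ+ →₀ ℕ) (c : ℂ) (Z : State) :
    quantize (MvPolynomial.monomial l (MvPolynomial.C c)) Z = c • iterDeriv l Z := by
  rw [quantize_eq_sum (T := {l}) MvPolynomial.support_monomial_subset, Finset.sum_singleton,
    MvPolynomial.coeff_monomial, if_pos rfl, MvPolynomial.coe_C, MvPowerSeries.smul_eq_C_mul]

theorem iterDeriv_single (n : ℕ+) (Z : State) :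
    iterDeriv (Finsupp.single n 1) Z = MvPowerSeries.pderiv ℂ n Z := by
  classical
  ext m
  rw [iterDeriv_coeff, MvPowerSeries.coeff_pderiv, mul_comm, Finsupp.prod,
    Finset.prod_eq_single n]
  · simp
  · intro k _ hk
    rw [Finsupp.single_eq_of_ne hk, Nat.descFactorial_zero, Nat.cast_one]
  · intro h
    simp at h

theorem constantCoeff_iterDeriv (l : ℕ+ →₀ ℕ) (Z : State) :
    MvPowerSeries.constantCoeff (iterDeriv l Z) =
      (l.prod fun _ e => (e.factorial : ℂ)) * MvPowerSeries.coeff l Z := by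
  rw [← MvPowerSeries.coeff_zero_eq_constantCoeff_apply, iterDeriv_coeff, zero_add]
  simp only [Nat.descFactorial_self, Finsupp.prod]

theorem orderingFactor_coeff_zero (p : ℕ) (hp : 0 < p) :
    PowerSeries.coeff 0 (orderingFactor p) = 1 := by
  have hp0 : (p : ℂ) ≠ 0 := by exact_mod_cast hp.ne'
  rw [orderingFactor, PowerSeries.coeff_zero_eq_constantCoeff_apply, map_mul,
    PowerSeries.binomialSeries_constantCoeff, PowerSeries.constantCoeff_inv,
    ← PowerSeries.coeff_zero_eq_constantCoeff_apply, PowerSeries.coeff_mk, zero_add,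
    Ring.choose_one_right, mul_inv_cancel₀ hp0, inv_one, one_mul]

section
variable (p : ℕ) {b b' : Background} {g : ℂ} {Z Z' : State}

/-- The index `p` is excluded because the linear coefficient of `orderingFactor` enters there; it
need not be computed, as index `p` carries no oscillator. -/
theorem wCurrent_one_coeff (hp : 0 < p) (J : Symbol⸨X⸩) (l : ℤ) (hl : l ≠ 1) :
    (wCurrent p J 1).coeff (p * l) = (p : ℂ) • J.coeff (p * l) := by
  have hl' : (p : ℤ) * l ≠ p := fun h => hl <| by
    have : (p : ℤ) * l = p * 1 := by rw [h, mul_one]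
    exact mul_left_cancel₀ (by exact_mod_cast hp.ne') this
  have h1 : oscNormal p J 1 = J := by
    have : dZeta p (1 : Symbol⸨X⸩) = 0 := by
      have := dZeta_ofZeta (R := Symbol) p hp 1
      rwa [map_one, Polynomial.derivative_one, map_zero] at this
    rw [oscNormal_succ, oscNormal, Function.iterate_zero_apply, this, zero_add, mul_one]
  rw [wCurrent, sum_sheet_coeff_mul p hp, wSheet, Finset.sum_range_succ, Finset.sum_range_one, h1]
  congr 1
  simp [orderingFactor_coeff_zero p hp, oscNormal, HahnSeries.coeff_single_of_ne, hl']

/-- For `n = pk` this is the constraint `W^1_k |Φ⟩ = 0`, because `W^1_k = α_{pk}`. -/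
theorem WConstraints.pderiv_eq_zero (hp : 0 < p) (h : WConstraints p g b Z) (n : ℕ+)
    (hn : p ∣ (n : ℕ)) : MvPowerSeries.pderiv ℂ n Z = 0 := by
  have hp0 : (p : ℂ) ≠ 0 := by exact_mod_cast hp.ne'
  obtain ⟨k, hk⟩ := hn
  have hk0 : k ≠ 0 := by
    rintro rfl
    exact n.pos.ne' (by rw [hk, mul_zero])
  refine MvPowerSeries.ext fun m => ?_
  have h1 := h.coeff_eq_zero p b m 1 le_rfl (k + 1) (by omega)
  have h2 : (p : ℤ) * (k + 1) = p + (n : ℕ) := by rw [hk]; push_cast; ring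
  rw [wCurrent_one_coeff p hp _ _ (by omega), h2, dphi, modeSeries_coeff_annihilation, smul_smul,
    mul_inv_cancel₀ hp0, one_smul, coeffQuantize_apply, MvPolynomial.X, ← map_one MvPolynomial.C,
    quantize_monomial, one_smul, iterDeriv_single] at h1
  rw [h1, map_zero]

/-- The exponent annihilates `Z`, so only the term `r = 0` of the exponential series survives. -/
theorem WConstraints.hasSum_reexpansion (hp : 0 < p) (hb : ∀ n : ℕ+, ¬ p ∣ (n : ℕ) → b' n = b n)
    (h : WConstraints p g b Z) : IsReexpansion g b b' Z Z := by
  intro m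
  set T : State → State := fun Y : State =>
    (b' - b).sum fun n c => (c / g) • MvPowerSeries.pderiv ℂ n Y with hT
  have hZ : T Z = 0 := by
    refine Finset.sum_eq_zero fun n hn => ?_
    have hpn : p ∣ (n : ℕ) := by
      by_contra h0
      rw [Finsupp.mem_support_iff, Finsupp.sub_apply, hb n h0, sub_self] at hn
      exact hn rfl
    simp only [h.pderiv_eq_zero p hp n hpn, smul_zero]
  have h0 : T 0 = 0 := by
    refine Finset.sum_eq_zero fun n hn => ?_
    simp only [map_zero, smul_zero]
  have hr : ∀ r, r ≠ 0 → T^[r] Z = 0 := fun r hr => by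
    obtain ⟨k, rfl⟩ := Nat.exists_eq_succ_of_ne_zero hr
    rw [Function.iterate_succ_apply, hZ, Function.iterate_fixed h0]
  have := hasSum_single (f := fun r : ℕ => ((r.factorial : ℂ)⁻¹) *
    MvPowerSeries.coeff m (T^[r] Z)) 0 fun r h' => by rw [hr r h', map_zero, mul_zero]
  simpa using this

theorem WConstraints.eq_of_reexpansion (hp : 0 < p) (hb : ∀ n : ℕ+, ¬ p ∣ (n : ℕ) → b' n = b n)
    (h : WConstraints p g b Z) (h' : IsReexpansion g b b' Z Z') : Z' = Z :=
  MvPowerSeries.ext fun m => (h' m).unique (h.hasSum_reexpansion p hp hb m)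

end

/-! ### Leading order of the correlation functions -/

/-- The chain rule holds for polynomials in `a`. Writing `f = X^N h + trunc`, its failure for `f` is
`a^N` times its failure for `h`, of order at least `N`, hence invisible in degree `e` once `N > deg
e`. -/
theorem pderiv_subst (f : ℂ⟦X⟧) {a : State} (ha : MvPowerSeries.constantCoeff a = 0) (n : ℕ+) :
    MvPowerSeries.pderiv ℂ n (f.subst a) =
      (PowerSeries.derivative ℂ f).subst a * MvPowerSeries.pderiv ℂ n a := by
  have hs : PowerSeries.HasSubst a := PowerSeries.HasSubst.of_constantCoeff_zero ha
  have hpoly : ∀ q : ℂ[X], MvPowerSeries.pderiv ℂ n ((q : ℂ⟦X⟧).subst a) =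
      (PowerSeries.derivative ℂ (q : ℂ⟦X⟧)).subst a * MvPowerSeries.pderiv ℂ n a := fun q => by
    rw [PowerSeries.subst_coe hs, PowerSeries.derivative_coe, PowerSeries.subst_coe hs,
      Derivation.comp_aeval_eq, smul_eq_mul]
  ext e
  set N := e.degree + 1
  set h : ℂ⟦X⟧ := PowerSeries.mk fun i => PowerSeries.coeff (i + N) f
  have hf : f = (PowerSeries.X ^ N : ℂ⟦X⟧) * h + (PowerSeries.trunc N f : ℂ[X]) :=
    PowerSeries.eq_X_pow_mul_shift_add_trunc N f
  have hX : PowerSeries.subst a (PowerSeries.X ^ N : ℂ⟦X⟧) = a ^ N := by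
    rw [PowerSeries.subst_pow hs, PowerSeries.subst_X hs]
  have hXN := hpoly (Polynomial.X ^ N)
  rw [Polynomial.coe_pow, Polynomial.coe_X, hX] at hXN
  have key : MvPowerSeries.pderiv ℂ n (f.subst a) -
      (PowerSeries.derivative ℂ f).subst a * MvPowerSeries.pderiv ℂ n a =
      a ^ N * (MvPowerSeries.pderiv ℂ n (h.subst a) -
        (PowerSeries.derivative ℂ h).subst a * MvPowerSeries.pderiv ℂ n a) := by
    rw [hf, map_add, Derivation.leibniz, PowerSeries.subst_add hs, PowerSeries.subst_mul hs,
      map_add, Derivation.leibniz, hpoly, hX, hXN]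
    simp only [smul_eq_mul]
    rw [PowerSeries.subst_add hs, PowerSeries.subst_add hs, PowerSeries.subst_mul hs,
      PowerSeries.subst_mul hs, hX]
    ring
  rw [← sub_eq_zero, ← map_sub, key]
  apply MvPowerSeries.coeff_of_lt_order
  refine lt_of_lt_of_le ?_ MvPowerSeries.le_order_mul
  refine lt_of_lt_of_le ?_ (le_add_right
    (MvPowerSeries.le_order_pow_of_constantCoeff_eq_zero N ha))
  exact_mod_cast Nat.lt_succ_self _

/-- The generating function of connected correlation functions satisfies `Z ∂F = ∂Z`. -/
theorem mul_pderiv_freeEnergy {Z : State} (hZ : MvPowerSeries.constantCoeff Z ≠ 0) (n : ℕ+) :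
    Z * MvPowerSeries.pderiv ℂ n (freeEnergy Z) = MvPowerSeries.pderiv ℂ n Z := by
  set c := MvPowerSeries.constantCoeff Z
  set u : State := MvPowerSeries.C c⁻¹ * Z - 1 with hu
  have hu0 : MvPowerSeries.constantCoeff u = 0 := by
    simp [hu, c, inv_mul_cancel₀ hZ]
  have hs : PowerSeries.HasSubst u := PowerSeries.HasSubst.of_constantCoeff_zero hu0
  have hlog : (1 + PowerSeries.X) * PowerSeries.derivative ℂ (PowerSeries.log ℂ) = 1 := by
    rw [PowerSeries.deriv_log]
    ext k
    rw [add_mul, one_mul, map_add]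
    cases k with
    | zero => simp
    | succ k => simp [PowerSeries.coeff_succ_X_mul, PowerSeries.coeff_one, pow_succ]
  have h1 := congrArg (PowerSeries.subst u) hlog
  rw [PowerSeries.subst_mul hs, PowerSeries.subst_add hs, PowerSeries.subst_X hs,
    ← PowerSeries.coe_substAlgHom hs, map_one, PowerSeries.coe_substAlgHom hs] at h1
  have h2 : Z = MvPowerSeries.C c * (1 + u) := by
    rw [hu, add_sub_cancel, ← mul_assoc, ← map_mul, mul_inv_cancel₀ hZ, map_one, one_mul]
  have h3 : MvPowerSeries.pderiv ℂ n Z = MvPowerSeries.C c * MvPowerSeries.pderiv ℂ n u := by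
    rw [h2, ← MvPowerSeries.smul_eq_C_mul, ← MvPowerSeries.smul_eq_C_mul, Derivation.map_smul,
      map_add, MvPowerSeries.pderiv_one, zero_add]
  have h4 : freeEnergy Z = (PowerSeries.log ℂ).subst u := rfl
  rw [h3, h4, pderiv_subst _ hu0]
  conv_lhs => rw [h2]
  calc _ = MvPowerSeries.C c * ((1 + u) * PowerSeries.subst u
        (PowerSeries.derivative ℂ (PowerSeries.log ℂ))) * MvPowerSeries.pderiv ℂ n u := by ring
    _ = _ := by rw [h1, mul_one]

open Filter

theorem prod_add_single_one (F : ℕ+ → ℕ → ℂ) (hF : ∀ n, F n 0 = 1) (m : ℕ+ →₀ ℕ) (n : ℕ+)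
    (d : ℂ) (hd : F n (m n + 1) = F n (m n) * d) :
    (m + Finsupp.single n 1).prod F = m.prod F * d := by
  classical
  set T := insert n m.support
  have hn : n ∈ T := Finset.mem_insert_self _ _
  have h1 : m.support ⊆ T := Finset.subset_insert _ _
  have h2 : (m + Finsupp.single n 1).support ⊆ T := fun k hk => by
    by_cases h : k = n
    · rw [h]; exact hn
    · apply h1
      rw [Finsupp.mem_support_iff, Finsupp.add_apply, Finsupp.single_eq_of_ne h, add_zero] at hk
      exact Finsupp.mem_support_iff.2 hk
  rw [Finsupp.prod_of_support_subset _ h1 _ fun k _ => hF k,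
    Finsupp.prod_of_support_subset _ h2 _ fun k _ => hF k, ← Finset.mul_prod_erase T _ hn,
    ← Finset.mul_prod_erase T _ hn, Finsupp.add_apply, Finsupp.single_eq_same]
  have : ∏ x ∈ T.erase n, F x ((m + Finsupp.single n 1 : ℕ+ →₀ ℕ) x) = ∏ x ∈ T.erase n, F x (m x) :=
    Finset.prod_congr rfl fun k hk => by
      rw [Finsupp.add_apply, Finsupp.single_eq_of_ne (Finset.ne_of_mem_erase hk), add_zero]
  rw [this, hd]
  ring

section
variable {Z : ℝ → State} {c : ℕ+ → ℂ}

/-- Rescaled connected correlation functions: only the one-point functions survive. -/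
theorem tendsto_coeff_freeEnergy (hZ : HasPlanarLimit Z)
    (hc : ∀ n, Tendsto (fun g : ℝ => (g : ℂ) * connected (Z g) (Finsupp.single n 1)) (𝓝[>] 0)
      (𝓝 (c n))) (m : ℕ+ →₀ ℕ) (n : ℕ+) :
    Tendsto (fun g : ℝ => (g : ℂ) ^ (m + Finsupp.single n 1).degree *
      MvPowerSeries.coeff (m + Finsupp.single n 1) (freeEnergy (Z g))) (𝓝[>] 0)
      (𝓝 (if m = 0 then c n else 0)) := by
  split_ifs with hm
  · subst hm
    refine (hc n).congr fun g => ?_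
    rw [connected, zero_add, Finsupp.prod_single_index (by simp), Finsupp.degree_single]
    simp
  · set l := m + Finsupp.single n 1 with hl
    have hdeg : l.degree = m.degree + 1 := by rw [hl, map_add, Finsupp.degree_single]
    have hmd : 1 ≤ m.degree := Nat.one_le_iff_ne_zero.2 fun h =>
      hm ((Finsupp.degree_eq_zero_iff m).1 h)
    obtain ⟨x, hx⟩ := hZ l fun h => by
      rw [h] at hdeg
      simp at hdeg
    have hfac : (l.prod fun _ e => (e.factorial : ℂ)) ≠ 0 :=
      Finset.prod_ne_zero_iff.2 fun _ _ => Nat.cast_ne_zero.2 (Nat.factorial_ne_zero _)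
    -- With `N = deg l = deg m + 1`, the weight `g^N` exceeds the convergent one `g^{2-N}` by
    -- `g^{2N-2} = g^{2 deg m}`, which tends to `0` as soon as `N ≥ 2`.
    have hg : Tendsto (fun g : ℝ => (g : ℂ) ^ (2 * m.degree)) (𝓝[>] 0) (𝓝 0) := by
      have h1 : Tendsto (fun g : ℝ => (g : ℂ) ^ (2 * m.degree)) (𝓝 0) (𝓝 (((0 : ℝ) : ℂ) ^ (2 * m.degree))) :=
        (Complex.continuous_ofReal.tendsto 0).pow _
      rw [Complex.ofReal_zero, zero_pow (by omega)] at h1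
      exact h1.mono_left nhdsWithin_le_nhds
    have := (hg.mul hx).mul_const (l.prod fun _ e => (e.factorial : ℂ))⁻¹
    rw [zero_mul, zero_mul] at this
    refine this.congr' ?_
    filter_upwards [self_mem_nhdsWithin] with g hg
    have hg0 : (g : ℂ) ≠ 0 := by exact_mod_cast (ne_of_gt hg)
    have hpow : (g : ℂ) ^ (2 * m.degree) * (g : ℂ) ^ (2 - (l.degree : ℤ)) = (g : ℂ) ^ l.degree := by
      rw [← zpow_natCast, ← zpow_natCast, ← zpow_add₀ hg0]
      congr 1
      rw [hdeg]
      push_cast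
      ring
    rw [← mul_assoc, hpow, connected]
    field_simp

/-- Leading order factorization of the correlation functions. -/
theorem tendsto_coeff_state (hZ0 : ∀ᶠ g : ℝ in 𝓝[>] 0, MvPowerSeries.constantCoeff (Z g) ≠ 0)
    (hZ : HasPlanarLimit Z)
    (hc : ∀ n, Tendsto (fun g : ℝ => (g : ℂ) * connected (Z g) (Finsupp.single n 1)) (𝓝[>] 0)
      (𝓝 (c n))) (N : ℕ) (m : ℕ+ →₀ ℕ) (hm : m.degree = N) :
    Tendsto (fun g : ℝ => (g : ℂ) ^ m.degree *
      (MvPowerSeries.coeff m (Z g) / MvPowerSeries.constantCoeff (Z g))) (𝓝[>] 0)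
      (𝓝 (m.prod fun n e => c n ^ e / (e.factorial : ℂ))) := by
  classical
  induction N using Nat.strong_induction_on generalizing m with
  | _ N ih =>
    rcases eq_or_ne m 0 with rfl | h0
    · rw [Finsupp.prod_zero_index]
      refine tendsto_const_nhds.congr' ?_
      filter_upwards [hZ0] with g hg
      rw [MvPowerSeries.coeff_zero_eq_constantCoeff_apply, div_self hg]
      simp
    · obtain ⟨n, hn⟩ := Finsupp.support_nonempty_iff.2 h0
      obtain ⟨k, rfl⟩ : ∃ k, m = k + Finsupp.single n 1 :=
        ⟨m - Finsupp.single n 1, (tsub_add_cancel_of_le (by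
          rw [Finsupp.single_le_iff]
          exact Nat.one_le_iff_ne_zero.2 (Finsupp.mem_support_iff.1 hn))).symm⟩
      have hk : k.degree + 1 = N := by rw [← hm, map_add, Finsupp.degree_single]
      have hk1 : (k n + 1 : ℂ) ≠ 0 := by exact_mod_cast Nat.succ_ne_zero (k n)
      have hsum : Tendsto (fun g : ℝ => ∑ ij ∈ Finset.HasAntidiagonal.antidiagonal k,
          ((g : ℂ) ^ ij.1.degree * (MvPowerSeries.coeff ij.1 (Z g) /
            MvPowerSeries.constantCoeff (Z g))) *
          (((g : ℂ) ^ (ij.2 + Finsupp.single n 1).degree *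
            MvPowerSeries.coeff (ij.2 + Finsupp.single n 1) (freeEnergy (Z g))) * (ij.2 n + 1 : ℂ)))
          (𝓝[>] 0) (𝓝 (∑ ij ∈ Finset.HasAntidiagonal.antidiagonal k,
            (ij.1.prod fun n e => c n ^ e / (e.factorial : ℂ)) *
              ((if ij.2 = 0 then c n else 0) * (ij.2 n + 1 : ℂ)))) := by
        refine tendsto_finsetSum _ fun ij hij => ?_
        rw [Finset.HasAntidiagonal.mem_antidiagonal] at hij
        have hd : ij.1.degree + ij.2.degree = k.degree := by rw [← hij, map_add]
        exact (ih ij.1.degree (by omega) ij.1 rfl).mul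
          ((tendsto_coeff_freeEnergy hZ hc ij.2 n).mul_const _)
      -- In the limit the factor taken from the free energy must be the one-point function of `n`,
      -- so the antidiagonal collapses to `(k, 0)`.
      have hval : (∑ ij ∈ Finset.HasAntidiagonal.antidiagonal k,
            (ij.1.prod fun n e => c n ^ e / (e.factorial : ℂ)) *
              ((if ij.2 = 0 then c n else 0) * (ij.2 n + 1 : ℂ))) =
          (k.prod fun n e => c n ^ e / (e.factorial : ℂ)) * c n := by
        rw [Finset.sum_eq_single (k, 0)]
        · simp
        · rintro ⟨i, j⟩ hij hne
          rw [Finset.HasAntidiagonal.mem_antidiagonal] at hij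
          have : j ≠ 0 := by
            rintro rfl
            exact hne (by rw [← hij, add_zero])
          simp [this]
        · intro h
          exact absurd (by simp) h
      have htarget : ((k + Finsupp.single n 1).prod fun n e => c n ^ e / (e.factorial : ℂ)) =
          ((k.prod fun n e => c n ^ e / (e.factorial : ℂ)) * c n) * (k n + 1 : ℂ)⁻¹ := by
        rw [mul_assoc]
        refine prod_add_single_one (fun n e => c n ^ e / (e.factorial : ℂ))
          (fun n => by simp) k n _ ?_
        have hf : ((k n).factorial : ℂ) ≠ 0 := by exact_mod_cast Nat.factorial_ne_zero _
        simp only [Nat.factorial_succ, pow_succ]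
        push_cast
        field_simp
      rw [hval] at hsum
      rw [htarget]
      refine (hsum.mul_const (k n + 1 : ℂ)⁻¹).congr' ?_
      filter_upwards [hZ0] with g hg
      -- The coefficient of `Z ∂_n F = ∂_n Z` at `k` is a recursion in the degree, and the powers of
      -- `g` split additively along the antidiagonal.
      have hrec := congrArg (MvPowerSeries.coeff k) (mul_pderiv_freeEnergy hg n)
      rw [MvPowerSeries.coeff_mul, MvPowerSeries.coeff_pderiv] at hrec
      rw [eq_comm, ← div_eq_mul_inv, eq_div_iff hk1, mul_assoc, div_mul_eq_mul_div, ← hrec,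
        Finset.sum_div, Finset.mul_sum]
      refine Finset.sum_congr rfl fun ij hij => ?_
      rw [Finset.HasAntidiagonal.mem_antidiagonal] at hij
      rw [MvPowerSeries.coeff_pderiv, ← hij, map_add, map_add, map_add, Finsupp.degree_single,
        add_assoc, pow_add]
      ring

end

/-! ### Currents with a formal coupling -/

section
variable {R S : Type*} [CommRing R] [Algebra ℂ R] [CommRing S] [Algebra ℂ S] (p : ℕ)

theorem mapCoeff_smul (φ : R →ₐ[ℂ] S) (c : ℂ) (f : R⸨X⸩) :
    mapCoeff (φ : R →+* S) (c • f) = c • mapCoeff (φ : R →+* S) f := by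
  ext i
  simp

/-- `(h ∂_ζ + J)^s 1`. -/
noncomputable def oscCoupled (h : R) (J : R⸨X⸩) (s : ℕ) : R⸨X⸩ :=
  (fun f => HahnSeries.C h * dZeta p f + J * f)^[s] 1

theorem oscCoupled_succ (h : R) (J : R⸨X⸩) (s : ℕ) :
    oscCoupled p h J (s + 1) =
      HahnSeries.C h * dZeta p (oscCoupled p h J s) + J * oscCoupled p h J s := by
  rw [oscCoupled, Function.iterate_succ_apply']
  rfl

theorem mapCoeff_oscCoupled (φ : R →ₐ[ℂ] S) (h : R) (J : R⸨X⸩) (s : ℕ) :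
    mapCoeff (φ : R →+* S) (oscCoupled p h J s) =
      oscCoupled p (φ h) (mapCoeff (φ : R →+* S) J) s := by
  induction s with
  | zero => simp [oscCoupled]
  | succ s ih =>
    rw [oscCoupled_succ, oscCoupled_succ, map_add, map_mul, map_mul, ← dZeta_mapCoeff, ih,
      HahnSeries.C_apply, mapCoeff_single]
    rfl

theorem oscCoupled_zero_left (J : R⸨X⸩) (s : ℕ) : oscCoupled p 0 J s = J ^ s := by
  induction s with
  | zero => simp [oscCoupled]
  | succ s ih => rw [oscCoupled_succ, ih, map_zero, zero_mul, zero_add, pow_succ']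

/-- Homogeneity: `g∂ + gJ = g(∂ + J)`. -/
theorem oscCoupled_smul (g : ℂ) (J : Symbol⸨X⸩) (s : ℕ) :
    oscCoupled p (algebraMap ℂ Symbol g) (g • J) s = g ^ s • oscNormal p J s := by
  induction s with
  | zero => simp [oscCoupled, oscNormal]
  | succ s ih =>
    rw [oscCoupled_succ, ih, oscNormal_succ, dZeta_smul]
    simp only [smul_eq_C_mul, map_pow]
    ring

/-- The current on the first sheet, with a formal coupling. -/
noncomputable def wSheetCoupled (h : R) (J : R⸨X⸩) (s : ℕ) : R⸨X⸩ :=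
  ∑ k ∈ Finset.range (s + 1),
    ((s.choose k : ℂ) * ((s - k).factorial : ℂ) *
        PowerSeries.coeff (s - k) (orderingFactor p)) •
      (HahnSeries.single ((p : ℤ) * ((s - k : ℕ) : ℤ)) (h ^ (s - k)) * oscCoupled p h J k)

/-- The sum over all sheets, with a formal coupling. -/
noncomputable def wCurrentCoupled (h : R) (J : R⸨X⸩) (s : ℕ) : R⸨X⸩ :=
  ∑ a ∈ Finset.range p, sheet p a (wSheetCoupled p h J s)

theorem mapCoeff_wCurrentCoupled (φ : R →ₐ[ℂ] S) (h : R) (J : R⸨X⸩) (s : ℕ) :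
    mapCoeff (φ : R →+* S) (wCurrentCoupled p h J s) =
      wCurrentCoupled p (φ h) (mapCoeff (φ : R →+* S) J) s := by
  rw [wCurrentCoupled, wCurrentCoupled, map_sum]
  refine Finset.sum_congr rfl fun a _ => ?_
  rw [← sheet_mapCoeff, wSheetCoupled, wSheetCoupled, map_sum]
  congr 1
  refine Finset.sum_congr rfl fun k _ => ?_
  rw [mapCoeff_smul, map_mul, mapCoeff_single, mapCoeff_oscCoupled, map_pow]
  rfl

/-- Every derivative and every ordering correction carries a positive power of the coupling. -/
theorem wCurrentCoupled_zero_left (hp : 0 < p) (J : R⸨X⸩) (s : ℕ) :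
    wCurrentCoupled p 0 J s = ∑ a ∈ Finset.range p, sheet p a (J ^ s) := by
  rw [wCurrentCoupled]
  refine Finset.sum_congr rfl fun a _ => ?_
  rw [wSheetCoupled, Finset.sum_eq_single s]
  · rw [oscCoupled_zero_left, Nat.sub_self, orderingFactor_coeff_zero p hp]
    simp
  · intro k hk hks
    have : s - k ≠ 0 := by
      have := Finset.mem_range.1 hk
      omega
    rw [zero_pow this, map_zero, zero_mul, smul_zero]
  · intro h
    simp at h

theorem sheet_smul (a : ℕ) (c : ℂ) (f : R⸨X⸩) : sheet p a (c • f) = c • sheet p a f := by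
  ext i
  rw [sheet_coeff, HahnSeries.coeff_smul, HahnSeries.coeff_smul, sheet_coeff, smul_comm]

theorem wCurrentCoupled_smul (g : ℂ) (J : Symbol⸨X⸩) (s : ℕ) :
    wCurrentCoupled p (algebraMap ℂ Symbol g) (g • J) s = g ^ s • wCurrent p J s := by
  rw [wCurrentCoupled, wCurrent, Finset.smul_sum]
  refine Finset.sum_congr rfl fun a _ => ?_
  rw [← sheet_smul, wSheetCoupled, wSheet, Finset.smul_sum]
  congr 1
  refine Finset.sum_congr rfl fun k hk => ?_
  have hk' : k ≤ s := Nat.lt_succ_iff.1 (Finset.mem_range.1 hk)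
  have h1 : (HahnSeries.single ((p : ℤ) * ((s - k : ℕ) : ℤ)) (algebraMap ℂ Symbol g ^ (s - k)) :
      Symbol⸨X⸩) = HahnSeries.C (algebraMap ℂ Symbol (g ^ (s - k))) *
        HahnSeries.single ((p : ℤ) * ((s - k : ℕ) : ℤ)) 1 := by
    rw [HahnSeries.C_apply, HahnSeries.single_mul_single, zero_add, mul_one,
      map_pow (algebraMap ℂ Symbol)]
  have h2 : g ^ s = g ^ (s - k) * g ^ k := by rw [← pow_add, Nat.sub_add_cancel hk']
  rw [oscCoupled_smul, h1, h2]
  simp only [smul_eq_C_mul, map_mul]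
  ring

end

/-! ### The planar limit of the currents -/

/-- Oscillators `α_n`, `n ≥ 1` (the variables `some n`), and a formal coupling (`none`). -/
abbrev CoupledSymbol := MvPolynomial (Option ℕ+) ℂ

/-- The symbol at coupling `g`, the oscillators being multiplied by `g`. -/
noncomputable def specialize (g : ℂ) : CoupledSymbol →ₐ[ℂ] Symbol :=
  MvPolynomial.aeval fun o => o.elim (algebraMap ℂ Symbol g) fun n => g • MvPolynomial.X n

/-- The planar limit, where the oscillators take the values `c`. -/
noncomputable def planar (c : ℕ+ → ℂ) : CoupledSymbol →ₐ[ℂ] ℂ :=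
  MvPolynomial.aeval fun o => o.elim 0 c

/-- `g ∂φ_0` with a formal coupling. -/
noncomputable def coupledDphi (p : ℕ) (b : Background) : CoupledSymbol⸨X⸩ :=
  modeSeries p (b.mapRange (algebraMap ℂ CoupledSymbol) (map_zero _))
    fun n => MvPolynomial.X (some n)

theorem mapCoeff_specialize_coupledDphi (p : ℕ) (b : Background) {g : ℂ} (hg : g ≠ 0) :
    mapCoeff (specialize g : CoupledSymbol →+* Symbol) (coupledDphi p b) = g • dphi p g b ∅ := by
  refine modeSeries_mapCoeff p (specialize g) _ _ _ _ g (fun n => ?_) (fun n => ?_)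
  · rw [Finset.sum_empty, add_zero, Finsupp.mapRange_apply, Finsupp.mapRange_apply,
      AlgHom.commutes, Algebra.smul_def, ← map_mul, mul_div_cancel₀ _ hg]
  · simp [specialize]

theorem mapCoeff_planar_coupledDphi (p : ℕ) (b : Background) (c : ℕ+ → ℂ) :
    mapCoeff (planar c : CoupledSymbol →+* ℂ) (coupledDphi p b) = modeSeries p b c := by
  have := modeSeries_mapCoeff p (planar c)
    (b.mapRange (algebraMap ℂ CoupledSymbol) (map_zero _)) (fun n => MvPolynomial.X (some n)) b c 1
    (fun n => by simp [planar]) (fun n => by simp [planar])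
  rwa [one_smul] at this

theorem vev_eq (Z : State) (O : Symbol⸨X⸩) (i : ℤ) :
    vev Z O i = coeffQuantize 0 Z (O.coeff i) / MvPowerSeries.constantCoeff Z := by
  rw [coeffQuantize_apply, MvPowerSeries.coeff_zero_eq_constantCoeff_apply]
  rfl

section
variable {Z : ℝ → State} {c : ℕ+ → ℂ}

/-- The monomial `l` records the oscillators already peeled off `r`: a variable `some n` moves into
`l` together with its factor `g`, while `none` contributes a bare factor `g → 0`. What remains is
the factorization of `tendsto_coeff_state`, whose factorials cancel those produced by
differentiation. -/
theorem tendsto_specialize (hZ0 : ∀ᶠ g : ℝ in 𝓝[>] 0, MvPowerSeries.constantCoeff (Z g) ≠ 0)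
    (hZ : HasPlanarLimit Z)
    (hc : ∀ n, Tendsto (fun g : ℝ => (g : ℂ) * connected (Z g) (Finsupp.single n 1)) (𝓝[>] 0)
      (𝓝 (c n))) (r : CoupledSymbol) (l : ℕ+ →₀ ℕ) :
    Tendsto (fun g : ℝ => (g : ℂ) ^ l.degree *
      (coeffQuantize 0 (Z g) (MvPolynomial.monomial l 1 * specialize g r) /
        MvPowerSeries.constantCoeff (Z g))) (𝓝[>] 0)
      (𝓝 ((l.prod fun n e => c n ^ e) * planar c r)) := by
  induction r using MvPolynomial.induction_on generalizing l with
  | C x =>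
    have h := (tendsto_coeff_state hZ0 hZ hc _ l rfl).mul_const
      ((l.prod fun _ e => (e.factorial : ℂ)) * x)
    have hfac : (l.prod fun _ e => (e.factorial : ℂ)) ≠ 0 :=
      Finset.prod_ne_zero_iff.2 fun _ _ => Nat.cast_ne_zero.2 (Nat.factorial_ne_zero _)
    have h1 : (l.prod fun n e => c n ^ e / (e.factorial : ℂ)) *
        ((l.prod fun _ e => (e.factorial : ℂ)) * x) =
        (l.prod fun n e => c n ^ e) * planar c (MvPolynomial.C x) := by
      simp only [Finsupp.prod] at hfac ⊢
      rw [Finset.prod_div_distrib, ← mul_assoc, div_mul_cancel₀ _ hfac]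
      simp [planar]
    rw [h1] at h
    refine h.congr fun g => ?_
    have h2 : (MvPolynomial.monomial l 1 * specialize g (MvPolynomial.C x) : Symbol) =
        x • MvPolynomial.monomial l (MvPolynomial.C 1) := by
      rw [← MvPolynomial.algebraMap_eq, AlgHom.commutes, mul_comm, ← Algebra.smul_def,
        MvPolynomial.C_1]
    rw [h2, map_smul, coeffQuantize_apply, quantize_monomial, one_smul,
      MvPowerSeries.coeff_zero_eq_constantCoeff_apply, constantCoeff_iterDeriv, smul_eq_mul]
    ring
  | add r t hr ht =>
    have := (hr l).add (ht l)
    rw [← mul_add, ← map_add] at this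
    refine this.congr fun g => ?_
    rw [map_add (specialize _), mul_add, map_add, add_div, mul_add]
  | mul_X r o hr =>
    cases o with
    | none =>
      have hg : Tendsto (fun g : ℝ => (g : ℂ)) (𝓝[>] 0) (𝓝 0) :=
        (Complex.continuous_ofReal.tendsto' 0 0 Complex.ofReal_zero).mono_left nhdsWithin_le_nhds
      have := hg.mul (hr l)
      have h0 : planar c (r * MvPolynomial.X none) = 0 := by simp [planar]
      rw [zero_mul] at this
      rw [h0, mul_zero]
      refine this.congr fun g => ?_
      have h2 : specialize g (r * MvPolynomial.X none) = (g : ℂ) • specialize g r := by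
        rw [map_mul, mul_comm, Algebra.smul_def]
        congr 1
        simp [specialize]
      rw [h2, mul_smul_comm, map_smul, smul_eq_mul]
      ring
    | some n =>
      have h1 : ((l + Finsupp.single n 1).prod fun n e => c n ^ e) * planar c r =
          (l.prod fun n e => c n ^ e) * planar c (r * MvPolynomial.X (some n)) := by
        rw [prod_add_single_one (fun n e => c n ^ e) (fun n => pow_zero _) l n (c n)
          (pow_succ _ _), map_mul]
        simp only [planar, MvPolynomial.aeval_X, Option.elim_some]
        ring
      rw [← h1]
      refine (hr (l + Finsupp.single n 1)).congr fun g => ?_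
      have h2 : (MvPolynomial.monomial l 1 * specialize g (r * MvPolynomial.X (some n)) : Symbol) =
          (g : ℂ) • (MvPolynomial.monomial (l + Finsupp.single n 1) 1 * specialize g r) := by
        have h3 : (MvPolynomial.monomial (l + Finsupp.single n 1) 1 : Symbol) =
            MvPolynomial.monomial l 1 * MvPolynomial.X n := by
          rw [MvPolynomial.X, MvPolynomial.monomial_mul, one_mul]
        rw [h3, map_mul]
        simp only [specialize, MvPolynomial.aeval_X, Option.elim_some]
        rw [mul_smul_comm, mul_smul_comm]
        congr 1
        ring
      rw [h2, map_smul, smul_eq_mul, map_add, Finsupp.degree_single, pow_succ]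
      ring

/-- For every `g ≠ 0`, `g^s W^s` is the specialization of one symbol independent of `g`, so its
limit is the planar evaluation of that symbol. -/
theorem tendsto_vev_wCurrent (p : ℕ) (hp : 0 < p) (b : Background)
    (hZ0 : ∀ᶠ g : ℝ in 𝓝[>] 0, MvPowerSeries.constantCoeff (Z g) ≠ 0)
    (hZ : HasPlanarLimit Z)
    (hc : ∀ n, Tendsto (fun g : ℝ => (g : ℂ) * connected (Z g) (Finsupp.single n 1)) (𝓝[>] 0)
      (𝓝 (c n))) (s : ℕ) (i : ℤ) :
    Tendsto (fun g : ℝ => (g : ℂ) ^ s * vev (Z g) (wCurrent p (dphi p g b ∅) s) i) (𝓝[>] 0)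
      (𝓝 ((∑ a ∈ Finset.range p, sheet p a (modeSeries p b c ^ s)).coeff i)) := by
  have h := tendsto_specialize hZ0 hZ hc
    ((wCurrentCoupled p (MvPolynomial.X none) (coupledDphi p b) s).coeff i) 0
  have h1 : planar c ((wCurrentCoupled p (MvPolynomial.X none) (coupledDphi p b) s).coeff i) =
      (∑ a ∈ Finset.range p, sheet p a (modeSeries p b c ^ s)).coeff i := by
    have h0 : planar c (MvPolynomial.X none) = 0 := by simp [planar]
    rw [← wCurrentCoupled_zero_left p hp, ← mapCoeff_planar_coupledDphi, ← h0,
      ← mapCoeff_wCurrentCoupled, mapCoeff_coeff]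
    rfl
  rw [Finsupp.prod_zero_index, one_mul, h1] at h
  refine h.congr' ?_
  filter_upwards [self_mem_nhdsWithin] with g hg
  have hg0 : (g : ℂ) ≠ 0 := by exact_mod_cast (ne_of_gt hg)
  have h2 : specialize g ((wCurrentCoupled p (MvPolynomial.X none) (coupledDphi p b) s).coeff i) =
      ((g : ℂ) ^ s • wCurrent p (dphi p g b ∅) s).coeff i := by
    have h0 : specialize g (MvPolynomial.X none) = algebraMap ℂ Symbol g := by simp [specialize]
    rw [← wCurrentCoupled_smul, ← mapCoeff_specialize_coupledDphi p b hg0, ← h0,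
      ← mapCoeff_wCurrentCoupled, mapCoeff_coeff]
    rfl
  have h3 : (MvPolynomial.monomial 0 1 : Symbol) = 1 := MvPolynomial.C_1
  rw [h2, h3, one_mul, HahnSeries.coeff_smul, map_smul, vev_eq, map_zero, pow_zero, one_mul,
    smul_eq_mul, mul_div_assoc]

theorem tendsto_vev_dphi (p : ℕ) (b : Background)
    (hZ0 : ∀ᶠ g : ℝ in 𝓝[>] 0, MvPowerSeries.constantCoeff (Z g) ≠ 0)
    (hZ : HasPlanarLimit Z)
    (hc : ∀ n, Tendsto (fun g : ℝ => (g : ℂ) * connected (Z g) (Finsupp.single n 1)) (𝓝[>] 0)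
      (𝓝 (c n))) : IsDiskAmplitude p b Z (modeSeries p b c) := by
  intro i
  have h := tendsto_specialize hZ0 hZ hc ((coupledDphi p b).coeff i) 0
  have h1 : planar c ((coupledDphi p b).coeff i) = (modeSeries p b c).coeff i := by
    rw [← mapCoeff_planar_coupledDphi, mapCoeff_coeff]
    rfl
  rw [Finsupp.prod_zero_index, one_mul, h1] at h
  refine h.congr' ?_
  filter_upwards [self_mem_nhdsWithin] with g hg
  have hg0 : (g : ℂ) ≠ 0 := by exact_mod_cast (ne_of_gt hg)
  have h2 : specialize g ((coupledDphi p b).coeff i) = ((g : ℂ) • dphi p g b ∅).coeff i := by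
    rw [← mapCoeff_specialize_coupledDphi p b hg0, mapCoeff_coeff]
    rfl
  have h3 : (MvPolynomial.monomial 0 1 : Symbol) = 1 := MvPolynomial.C_1
  rw [h2, h3, one_mul, HahnSeries.coeff_smul, map_smul, vev_eq, map_zero, pow_zero, one_mul,
    smul_eq_mul, mul_div_assoc]

/-- The planar limit of the constraints. -/
theorem sum_sheet_pow_coeff_eq_zero (p : ℕ) (hp : 0 < p) (b : Background)
    (hZ0 : ∀ᶠ g : ℝ in 𝓝[>] 0, MvPowerSeries.constantCoeff (Z g) ≠ 0 ∧ WConstraints p g b (Z g))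
    (hZ : HasPlanarLimit Z)
    (hc : ∀ n, Tendsto (fun g : ℝ => (g : ℂ) * connected (Z g) (Finsupp.single n 1)) (𝓝[>] 0)
      (𝓝 (c n))) (s : ℕ) (hs : 1 ≤ s) (N : ℤ) (hN : 1 ≤ N) :
    (∑ a ∈ Finset.range p, sheet p a (modeSeries p b c ^ s)).coeff (p * N) = 0 := by
  refine tendsto_nhds_unique (tendsto_vev_wCurrent p hp b (hZ0.mono fun _ h => h.1) hZ hc s (p * N))
    (tendsto_const_nhds.congr' ?_)
  filter_upwards [hZ0] with g hg
  have := hg.2.coeff_eq_zero p b 0 s hs N hN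
  rw [Finsupp.support_zero] at this
  rw [vev_eq, this, zero_div, mul_zero]

end

/-! ### Schur polynomials and Newton's identities -/

theorem schur_eq_coeff_subst (x : ℕ → ℂ[X]) (k : ℕ) :
    schur x k = PowerSeries.coeff k ((PowerSeries.exp ℂ[X]).subst
      (PowerSeries.mk fun s => if s = 0 then 0 else x s : ℂ[X]⟦X⟧)) := by
  have hs : PowerSeries.HasSubst (PowerSeries.mk fun s => if s = 0 then 0 else x s : ℂ[X]⟦X⟧) :=
    PowerSeries.HasSubst.of_constantCoeff_zero' (by
      rw [← PowerSeries.coeff_zero_eq_constantCoeff_apply, PowerSeries.coeff_mk, if_pos rfl])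
  rw [schur, PowerSeries.coeff_subst' hs, PowerSeries.coeff_subst' hs]
  refine finsum_congr fun d => ?_
  rw [← PowerSeries.map_exp (algebraMap ℂ ℂ[X]), PowerSeries.coeff_map, algebraMap_smul]

theorem schur_zero (x : ℕ → ℂ[X]) : schur x 0 = 1 := by
  set A : ℂ[X]⟦X⟧ := PowerSeries.mk fun s => if s = 0 then 0 else x s with hA
  have h0 : PowerSeries.constantCoeff A = 0 := by
    rw [← PowerSeries.coeff_zero_eq_constantCoeff_apply, hA, PowerSeries.coeff_mk, if_pos rfl]
  have hs : PowerSeries.HasSubst A := PowerSeries.HasSubst.of_constantCoeff_zero' h0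
  rw [schur_eq_coeff_subst, PowerSeries.coeff_subst' hs, finsum_eq_single _ 0]
  · simp
  · intro d hd
    rw [PowerSeries.coeff_zero_eq_constantCoeff_apply, map_pow, h0, zero_pow hd, smul_zero]

/-- Compare coefficients in `(exp A)' = exp(A) A'`. The recursion has the same shape as Newton's
identities in `esymm_succ`. -/
theorem schur_succ (x : ℕ → ℂ[X]) (k : ℕ) :
    ((k + 1 : ℕ) : ℂ[X]) * schur x (k + 1) =
      ∑ ij ∈ Finset.HasAntidiagonal.antidiagonal k,
        schur x ij.1 * (((ij.2 + 1 : ℕ) : ℂ[X]) * x (ij.2 + 1)) := by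
  set A : ℂ[X]⟦X⟧ := PowerSeries.mk fun s => if s = 0 then 0 else x s with hA
  have h0 : PowerSeries.constantCoeff A = 0 := by
    rw [← PowerSeries.coeff_zero_eq_constantCoeff_apply, hA, PowerSeries.coeff_mk, if_pos rfl]
  have hs : PowerSeries.HasSubst A := PowerSeries.HasSubst.of_constantCoeff_zero' h0
  have h := congrArg (PowerSeries.coeff k)
    (PowerSeries.derivative_subst (f := PowerSeries.exp ℂ[X]) hs)
  rw [PowerSeries.derivative_exp, PowerSeries.coeff_derivative, PowerSeries.coeff_mul] at h
  simp only [schur_eq_coeff_subst, ← hA]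
  rw [mul_comm]
  push_cast
  rw [h]
  refine Finset.sum_congr rfl fun ij _ => ?_
  rw [PowerSeries.coeff_derivative, hA, PowerSeries.coeff_mk, if_neg (Nat.succ_ne_zero _)]
  ring

theorem esymm_succ {K : Type*} [CommRing K] {σ : Type*} [Fintype σ] (y : σ → K) (k : ℕ) :
    ((k + 1 : ℕ) : K) * ((-1) ^ (k + 1) * (Finset.univ.val.map y).esymm (k + 1)) =
      ∑ ij ∈ Finset.HasAntidiagonal.antidiagonal k,
        ((-1) ^ ij.1 * (Finset.univ.val.map y).esymm ij.1) * -∑ a, y a ^ (ij.2 + 1) := by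
  classical
  have h := congrArg (MvPolynomial.aeval y) (MvPolynomial.mul_esymm_eq_sum σ ℤ (k + 1))
  rw [Finset.sum_filter, Finset.Nat.sum_antidiagonal_succ', if_neg (lt_irrefl _), zero_add] at h
  have h2 : ∀ ij ∈ Finset.HasAntidiagonal.antidiagonal k, (if ij.1 < k + 1 then
      (-1) ^ ij.1 * MvPolynomial.esymm σ ℤ ij.1 * MvPolynomial.psum σ ℤ (ij.2 + 1) else 0) =
      (-1) ^ ij.1 * MvPolynomial.esymm σ ℤ ij.1 * MvPolynomial.psum σ ℤ (ij.2 + 1) :=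
    fun ij hij => by
      rw [Finset.HasAntidiagonal.mem_antidiagonal] at hij
      rw [if_pos (by omega)]
  rw [Finset.sum_congr rfl h2] at h
  simp only [map_mul, map_sum, map_pow, map_neg, map_one, map_natCast,
    MvPolynomial.aeval_esymm_eq_multiset_esymm, MvPolynomial.psum, MvPolynomial.aeval_X] at h
  rw [mul_left_comm, h, ← mul_assoc, ← pow_add,
    show k + 1 + (k + 1 + 1) = 2 * (k + 1) + 1 by ring, pow_succ, pow_mul, neg_one_sq, one_pow,
    one_mul, neg_one_mul, ← Finset.sum_neg_distrib]
  refine Finset.sum_congr rfl fun ij _ => ?_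
  rw [mul_neg]

/-- Newton's identities: the Schur polynomials of the normalized power sums are the elementary
symmetric functions. -/
theorem map_schur_eq_esymm {K : Type*} [Field K] [CharZero K] {σ : Type*} [Fintype σ]
    (φ : ℂ[X] →+* K) (x : ℕ → ℂ[X]) (y : σ → K)
    (h : ∀ s : ℕ, 1 ≤ s → φ ((s : ℂ[X]) * x s) = -∑ a, y a ^ s) (k : ℕ) :
    φ (schur x k) = (-1) ^ k * (Finset.univ.val.map y).esymm k := by
  induction k using Nat.strong_induction_on with
  | _ k ih =>
    cases k with
    | zero => simp [schur_zero, Multiset.esymm]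
    | succ k =>
      have hk : ((k + 1 : ℕ) : K) ≠ 0 := Nat.cast_ne_zero.2 (Nat.succ_ne_zero k)
      apply mul_left_cancel₀ hk
      rw [esymm_succ, ← map_natCast φ, ← map_mul, schur_succ, map_sum]
      refine Finset.sum_congr rfl fun ij hij => ?_
      rw [Finset.HasAntidiagonal.mem_antidiagonal] at hij
      rw [map_mul, ih ij.1 (by omega), h _ (Nat.succ_pos _)]

/-! ### The curve -/

section
variable (p : ℕ) {Q : ℂ⸨X⸩}

/-- The sum over sheets removes fractional powers of `ζ` and the hypothesis removes negative ones;
the polynomial part is left, counted once per sheet. -/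
theorem sum_sheet_pow_eq (hp : 0 < p) (s : ℕ) (hs : 1 ≤ s)
    (h : ∀ N : ℤ, 1 ≤ N → (∑ a ∈ Finset.range p, sheet p a (Q ^ s)).coeff (p * N) = 0) :
    ∑ a ∈ Finset.range p, sheet p a Q ^ s = (s : ℂ) • ofZeta p ℂ (aPoly p Q s) := by
  have hs0 : (s : ℂ) ≠ 0 := by exact_mod_cast (Nat.one_le_iff_ne_zero.1 hs)
  have h1 : ∑ a ∈ Finset.range p, sheet p a Q ^ s = ∑ a ∈ Finset.range p, sheet p a (Q ^ s) :=
    Finset.sum_congr rfl fun a _ => (map_pow (sheetHom p a) Q s).symm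
  rw [h1, smul_ofZeta p hp, aPoly, smul_smul, mul_div_cancel₀ _ hs0]
  ext i
  by_cases hi : (p : ℤ) ∣ i
  · obtain ⟨N, rfl⟩ := hi
    rcases le_or_gt 1 N with hN | hN
    · rw [h N hN, ofZeta_coeff_of_pos p _ _ (by positivity)]
    · obtain ⟨l, rfl⟩ : ∃ l : ℕ, N = -l := ⟨(-N).toNat, by omega⟩
      rw [sum_sheet_coeff_mul p hp, mul_neg, ofZeta_coeff_neg_mul p hp, Polynomial.coeff_smul,
        polPart_coeff p hp]
      rfl
  · rw [sum_sheet_coeff_of_not_dvd p hp _ hi, ofZeta_coeff_of_ne]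
    rintro l rfl
    exact hi (dvd_neg.2 (dvd_mul_right _ _))

theorem curve_map_eq_prod (hp : 0 < p)
    (h : ∀ s : ℕ, 1 ≤ s →
      ∑ a ∈ Finset.range p, sheet p a Q ^ s = (s : ℂ) • ofZeta p ℂ (aPoly p Q s)) :
    (curve p Q).map (ofZeta p ℂ : ℂ[X] →+* ℂ⸨X⸩) =
      ∏ a ∈ Finset.range p, (Polynomial.X - Polynomial.C (sheet p a Q)) := by
  set y : Fin p → ℂ⸨X⸩ := fun a => sheet p a Q with hy
  have hchar : CharZero ℂ⸨X⸩ := charZero_of_injective_ringHom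
    (HahnSeries.C_injective (Γ := ℤ) (R := ℂ))
  have hnewton := map_schur_eq_esymm (ofZeta p ℂ : ℂ[X] →+* ℂ⸨X⸩) (fun s => -aPoly p Q s) y
    fun s hs => by
      rw [mul_neg, map_neg, ← Finset.sum_range fun a => sheet p a Q ^ s, h s hs,
        smul_ofZeta p hp, ← nsmul_eq_mul, ← Nat.cast_smul_eq_nsmul ℂ]
      rfl
  have hprod := Multiset.prod_X_sub_X_eq_sum_esymm (Finset.univ.val.map y)
  rw [Multiset.map_map, Multiset.card_map, Finset.card_val, Finset.card_univ, Fintype.card_fin]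
    at hprod
  rw [Finset.prod_range fun a => Polynomial.X - Polynomial.C (sheet p a Q)]
  refine Eq.trans ?_ hprod.symm
  rw [curve, Polynomial.map_sum]
  refine Finset.sum_congr rfl fun k _ => ?_
  rw [Polynomial.map_mul, Polynomial.map_C, hnewton, Polynomial.map_pow, Polynomial.map_X, map_mul,
    map_pow, map_neg, map_one, mul_assoc]

/-- Over Laurent series both sides split into the same linear factors, and `ℂ[ζ]` embeds there. -/
theorem curve_eq_comp (hp : 0 < p) {Q' : ℂ⸨X⸩} (d : ℂ[X]) (hQ : Q' = Q - ofZeta p ℂ d)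
    (h : (curve p Q).map (ofZeta p ℂ : ℂ[X] →+* ℂ⸨X⸩) =
      ∏ a ∈ Finset.range p, (Polynomial.X - Polynomial.C (sheet p a Q)))
    (h' : (curve p Q').map (ofZeta p ℂ : ℂ[X] →+* ℂ⸨X⸩) =
      ∏ a ∈ Finset.range p, (Polynomial.X - Polynomial.C (sheet p a Q'))) :
    curve p Q = (curve p Q').comp (Polynomial.X - Polynomial.C d) := by
  apply Polynomial.map_injective _ (ofZeta_injective p hp)
  refine h.trans ?_
  rw [Polynomial.map_comp]
  refine Eq.trans ?_ (congrArg (fun q => Polynomial.comp q _) h'.symm)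
  rw [Polynomial.prod_comp]
  refine Finset.prod_congr rfl fun a _ => ?_
  have h1 : sheet p a Q' = sheet p a Q - ofZeta p ℂ d := by
    rw [hQ, ← sheetHom_apply, map_sub, sheetHom_apply, sheetHom_apply, sheet_ofZeta p hp]
  rw [h1]
  simp

end

/-! ### The zero locus and the coordinate ring under the shift -/

section
variable {F F' : ℂ[X][X]} {d : ℂ[X]}

theorem image_zeroLocus_of_eq_comp (h : F = F'.comp (Polynomial.X - Polynomial.C d)) :
    (fun x : ℂ × ℂ => (x.1, x.2 - d.eval x.1)) '' {x : ℂ × ℂ | F.evalEval x.1 x.2 = 0} =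
      {x : ℂ × ℂ | F'.evalEval x.1 x.2 = 0} := by
  have key : ∀ u v : ℂ, F.evalEval u v = F'.evalEval u (v - d.eval u) := fun u v => by
    have h1 : ∀ (G : ℂ[X][X]) (q : ℂ[X]), (G.eval q).eval u = G.evalEval u (q.eval u) :=
      fun G q => by
        rw [Polynomial.evalEval]
        induction G using Polynomial.induction_on' with
        | add G H hG hH => simp [hG, hH]
        | monomial k c => simp
    rw [h, Polynomial.evalEval, Polynomial.eval_comp, h1]
    simp
  ext ⟨u, v⟩
  constructor
  · rintro ⟨⟨u', v'⟩, hx, hxy⟩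
    rw [Prod.mk.injEq] at hxy
    obtain ⟨rfl, rfl⟩ := hxy
    exact (key _ _).symm.trans hx
  · intro hx
    refine ⟨(u, v + d.eval u), ?_, ?_⟩
    · refine (key _ _).trans ?_
      rw [add_sub_cancel_right]
      exact hx
    · simp

/-- The substitutions `Q ↦ Q + d` and `Q ↦ Q - d` respect the relations and are mutually inverse. -/
theorem exists_adjoinRoot_equiv (h : F = F'.comp (Polynomial.X - Polynomial.C d)) :
    ∃ e : AdjoinRoot F ≃ₐ[ℂ[X]] AdjoinRoot F',
      e (AdjoinRoot.root F) = AdjoinRoot.root F' + algebraMap ℂ[X] (AdjoinRoot F') d := by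
  have h' : F' = F.comp (Polynomial.X + Polynomial.C d) := by
    rw [h, Polynomial.comp_assoc]
    simp
  have h1 : Polynomial.eval₂ (Algebra.ofId ℂ[X] (AdjoinRoot F') : ℂ[X] →+* AdjoinRoot F')
      (AdjoinRoot.root F' + algebraMap ℂ[X] (AdjoinRoot F') d) F = 0 := by
    change Polynomial.aeval _ F = 0
    rw [h, Polynomial.aeval_comp]
    simp [AdjoinRoot.aeval_eq]
  have h2 : Polynomial.eval₂ (Algebra.ofId ℂ[X] (AdjoinRoot F) : ℂ[X] →+* AdjoinRoot F)
      (AdjoinRoot.root F - algebraMap ℂ[X] (AdjoinRoot F) d) F' = 0 := by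
    change Polynomial.aeval _ F' = 0
    rw [h', Polynomial.aeval_comp]
    simp [AdjoinRoot.aeval_eq]
  refine ⟨AlgEquiv.ofAlgHom (AdjoinRoot.liftAlgHom F (Algebra.ofId _ _) _ h1)
    (AdjoinRoot.liftAlgHom F' (Algebra.ofId _ _) _ h2) ?_ ?_, ?_⟩
  · apply AdjoinRoot.algHom_ext
    rw [AlgHom.comp_apply, AdjoinRoot.liftAlgHom_root, map_sub, AdjoinRoot.liftAlgHom_root,
      AlgHom.commutes, add_sub_cancel_right]
    rfl
  · apply AdjoinRoot.algHom_ext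
    rw [AlgHom.comp_apply, AdjoinRoot.liftAlgHom_root, map_add, AdjoinRoot.liftAlgHom_root,
      AlgHom.commutes, sub_add_cancel]
    rfl
  · exact AdjoinRoot.liftAlgHom_root F (Algebra.ofId _ _) _ h1

end

theorem HasPlanarLimit.congr {Z Z' : ℝ → State} (hZ : HasPlanarLimit Z)
    (h : ∀ᶠ g : ℝ in 𝓝[>] 0, Z' g = Z g) : HasPlanarLimit Z' := fun m hm => by
  obtain ⟨x, hx⟩ := hZ m hm
  refine ⟨x, hx.congr' ?_⟩
  filter_upwards [h] with g hg
  rw [hg]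

/-- The amplitudes `c` sit at indices above `p`, whereas the polynomial part reads only indices at
most `0`. -/
theorem aPoly_one (p : ℕ) (hp : 0 < p) (b : Background) (c : ℕ+ → ℂ) :
    aPoly p (modeSeries p b c) 1 = aOne p b := by
  rw [aPoly, aOne, pow_one, Nat.cast_one, div_one]
  congr 1
  ext l
  rw [polPart_coeff p hp, polPart_coeff p hp]
  have h : -((p : ℤ) * l) < p := by
    have : (0 : ℤ) ≤ p * l := by positivity
    have : (0 : ℤ) < p := by exact_mod_cast hp
    linarith
  rcases int_trichotomy_modes p (-((p : ℤ) * l)) with h' | ⟨n, h'⟩ | ⟨n, h'⟩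
  · omega
  · rw [h', modeSeries_coeff_creation, modeSeries_coeff_creation]
  · omega

theorem curve_eq_sum (p : ℕ) {Q Q' : ℂ⸨X⸩} {d : ℂ[X]}
    (h : curve p Q = (curve p Q').comp (Polynomial.X - Polynomial.C d)) :
    curve p Q = ∑ k ∈ Finset.range (p + 1), (Polynomial.X - Polynomial.C d) ^ k *
      Polynomial.C (schur (fun s => -aPoly p Q' s) (p - k)) := by
  rw [h, curve, ← Polynomial.coe_compRingHom_apply, map_sum, ← Finset.sum_range_reflect]
  refine Finset.sum_congr rfl fun k hk => ?_
  have hk' : k ≤ p := Nat.lt_succ_iff.1 (Finset.mem_range.1 hk)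
  rw [Polynomial.coe_compRingHom_apply, Polynomial.mul_comp, Polynomial.C_comp,
    Polynomial.pow_comp, Polynomial.X_comp, mul_comm,
    show p + 1 - 1 - k = p - k by omega, Nat.sub_sub_self hk']

/-- The background without the modes divisible by `p`. -/
theorem exists_background_aOne_eq_zero (p : ℕ) (hp : 0 < p) (b : Background) :
    ∃ b₀ : Background, (∀ n : ℕ+, ¬ p ∣ (n : ℕ) → b₀ n = b n) ∧
      (∀ n : ℕ+, p ∣ (n : ℕ) → b₀ n = 0) ∧ aOne p b₀ = 0 := by
  classical
  have h0 : ∀ n : ℕ+, p ∣ (n : ℕ) → b.filter (fun n : ℕ+ => ¬ p ∣ (n : ℕ)) n = 0 :=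
    fun n hn => Finsupp.filter_apply_neg _ _ (not_not.2 hn)
  exact ⟨b.filter fun n : ℕ+ => ¬ p ∣ (n : ℕ), fun n hn => Finsupp.filter_apply_pos _ _ hn, h0,
    aOne_eq_zero p _ hp h0⟩

end MinimalString
open MinimalString in
theorem mainTheorem11 (p : ℕ) (hp : 0 < p) (b : Background) :
    (∀ b' : Background, (∀ n : ℕ+, ¬ p ∣ (n : ℕ) → b' n = b n) →
      -- finite string coupling
      (∀ (g : ℂ) (Z : State), g ≠ 0 → MvPowerSeries.constantCoeff Z ≠ 0 →
        WConstraints p g b Z →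
        ∃ Z' : State, IsReexpansion g b b' Z Z' ∧ MvPowerSeries.constantCoeff Z' ≠ 0 ∧
          WConstraints p g b' Z' ∧
          ∀ (s : ℕ) (i : ℤ), 1 ≤ s →
            vev Z' (wCurrent p (dphi p g b' ∅) s) i =
              vev Z (wCurrent p (dphi p g b ∅ - g⁻¹ • ofZeta p Symbol (shift p b b')) s) i) ∧
      -- weak coupling limit
      (∀ Z Z' : ℝ → State,
        (∀ᶠ g : ℝ in 𝓝[>] 0, MvPowerSeries.constantCoeff (Z g) ≠ 0 ∧
          WConstraints p g b (Z g) ∧ IsReexpansion g b b' (Z g) (Z' g)) →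
        HasPlanarLimit Z →
        HasPlanarLimit Z' ∧
        ∃ Q Q' : ℂ⸨X⸩, IsDiskAmplitude p b Z Q ∧ IsDiskAmplitude p b' Z' Q' ∧
          aPoly p Q 1 = aOne p b ∧ aPoly p Q' 1 = aOne p b' ∧
          Q' = Q - ofZeta p ℂ (shift p b b') ∧
          (∀ (s : ℕ) (i : ℤ), 1 ≤ s →
            Filter.Tendsto
              (fun g : ℝ => (g : ℂ) ^ s * vev (Z' g) (wCurrent p (dphi p g b' ∅) s) i) (𝓝[>] 0)
              (𝓝 ((∑ a ∈ Finset.range p,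
                (sheet p a Q - ofZeta p ℂ (shift p b b')) ^ s).coeff i))) ∧
          (∀ s : ℕ, 1 ≤ s →
            ∑ a ∈ Finset.range p, (sheet p a Q - ofZeta p ℂ (shift p b b')) ^ s =
                ∑ a ∈ Finset.range p, sheet p a Q' ^ s ∧
              ∑ a ∈ Finset.range p, sheet p a Q' ^ s =
                (s : ℂ) • ofZeta p ℂ (aPoly p Q' s)) ∧
          -- the polynomials of the two curves
          (curve p Q).map (ofZeta p ℂ : ℂ[X] →+* ℂ⸨X⸩) =
            ∏ a ∈ Finset.range p, (Polynomial.X - Polynomial.C (sheet p a Q)) ∧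
          (curve p Q).map (ofZeta p ℂ : ℂ[X] →+* ℂ⸨X⸩) =
            ∏ a ∈ Finset.range p,
              (Polynomial.X - Polynomial.C (ofZeta p ℂ (shift p b b')) -
                Polynomial.C (sheet p a Q')) ∧
          curve p Q = ∑ k ∈ Finset.range (p + 1),
            (Polynomial.X - Polynomial.C (shift p b b')) ^ k *
              Polynomial.C (schur (fun s => -aPoly p Q' s) (p - k)) ∧
          curve p Q = (curve p Q').comp (Polynomial.X - Polynomial.C (shift p b b')) ∧
          -- the curves agree, as sets up to the shift and as algebras over `ℂ[ζ]`
          (fun x : ℂ × ℂ => (x.1, x.2 - (shift p b b').eval x.1)) ''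
              {x : ℂ × ℂ | (curve p Q).evalEval x.1 x.2 = 0} =
            {x : ℂ × ℂ | (curve p Q').evalEval x.1 x.2 = 0} ∧
          ∃ e : AdjoinRoot (curve p Q) ≃ₐ[ℂ[X]] AdjoinRoot (curve p Q'),
            e (AdjoinRoot.root (curve p Q)) =
              AdjoinRoot.root (curve p Q') +
                algebraMap ℂ[X] (AdjoinRoot (curve p Q')) (shift p b b'))) ∧
    -- the multiples of `p` can be removed from the background, and then `a_1 = 0`
    ∃ b₀ : Background, (∀ n : ℕ+, ¬ p ∣ (n : ℕ) → b₀ n = b n) ∧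
      (∀ n : ℕ+, p ∣ (n : ℕ) → b₀ n = 0) ∧ aOne p b₀ = 0 := by
  refine ⟨fun b' hb => ⟨fun g Z _ hZ0 hZ => ?_, fun Z Z' hZ hlim => ?_⟩,
    exists_background_aOne_eq_zero p hp b⟩
  · refine ⟨Z, hZ.hasSum_reexpansion p hp hb, hZ0, hZ.change_background p b b' hp hb,
      fun s i _ => ?_⟩
    rw [dphi_eq_sub p b b' hp hb]
  · have heq : ∀ᶠ g : ℝ in 𝓝[>] 0, Z' g = Z g :=
      hZ.mono fun g h => h.2.1.eq_of_reexpansion p hp hb h.2.2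
    have hlim' : HasPlanarLimit Z' := hlim.congr heq
    -- The genus weight of a one-point function is `g^{2-1} = g`. As `Z' = Z` for small `g`, the
    -- same limits `c` give the annihilation part of both `Q` and `Q'`.
    have hex : ∀ n : ℕ+, ∃ c : ℂ, Filter.Tendsto
        (fun g : ℝ => (g : ℂ) * connected (Z g) (Finsupp.single n 1)) (𝓝[>] 0) (𝓝 c) := fun n => by
      obtain ⟨c, hc⟩ := hlim (Finsupp.single n 1) (by simp)
      exact ⟨c, by simpa [Finsupp.degree_single] using hc⟩
    choose c hc using hex
    have hc' : ∀ n, Filter.Tendsto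
        (fun g : ℝ => (g : ℂ) * connected (Z' g) (Finsupp.single n 1)) (𝓝[>] 0) (𝓝 (c n)) :=
      fun n => (hc n).congr' (heq.mono fun g h => by simp only [h])
    have hW : ∀ᶠ g : ℝ in 𝓝[>] 0,
        MvPowerSeries.constantCoeff (Z g) ≠ 0 ∧ WConstraints p g b (Z g) :=
      hZ.mono fun g h => ⟨h.1, h.2.1⟩
    have hW' : ∀ᶠ g : ℝ in 𝓝[>] 0,
        MvPowerSeries.constantCoeff (Z' g) ≠ 0 ∧ WConstraints p g b' (Z' g) := by
      filter_upwards [heq, hW] with g h1 h2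
      rw [h1]
      exact ⟨h2.1, h2.2.change_background p b b' hp hb⟩
    have hZ0 := hW.mono fun g h => h.1
    have hZ0' := hW'.mono fun g h => h.1
    set Q := modeSeries p b c with hQ
    set Q' := modeSeries p b' c with hQ'
    have hQQ' : Q' = Q - ofZeta p ℂ (shift p b b') := by
      have := modeSeries_eq_sub p b b' hp hb 1 b b' c fun n => by simp
      rwa [one_smul] at this
    have hsheet : ∀ a, sheet p a Q' = sheet p a Q - ofZeta p ℂ (shift p b b') := fun a => by
      rw [hQQ', ← sheetHom_apply, map_sub, sheetHom_apply, sheetHom_apply, sheet_ofZeta p hp]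
    have hpow : ∀ s : ℕ, 1 ≤ s →
        ∑ a ∈ Finset.range p, sheet p a Q ^ s = (s : ℂ) • ofZeta p ℂ (aPoly p Q s) :=
      fun s hs => sum_sheet_pow_eq p hp s hs
        (sum_sheet_pow_coeff_eq_zero p hp b hW hlim hc s hs)
    have hpow' : ∀ s : ℕ, 1 ≤ s →
        ∑ a ∈ Finset.range p, sheet p a Q' ^ s = (s : ℂ) • ofZeta p ℂ (aPoly p Q' s) :=
      fun s hs => sum_sheet_pow_eq p hp s hs
        (sum_sheet_pow_coeff_eq_zero p hp b' hW' hlim' hc' s hs)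
    have hcurve := curve_map_eq_prod p hp hpow
    have hcurve' := curve_map_eq_prod p hp hpow'
    have hcomp := curve_eq_comp p hp (shift p b b') hQQ' hcurve hcurve'
    refine ⟨hlim', Q, Q', tendsto_vev_dphi p b hZ0 hlim hc, tendsto_vev_dphi p b' hZ0' hlim' hc',
      aPoly_one p hp b c, aPoly_one p hp b' c, hQQ', fun s i _ => ?_, fun s hs => ⟨?_, hpow' s hs⟩,
      hcurve, ?_, curve_eq_sum p hcomp, hcomp, image_zeroLocus_of_eq_comp hcomp,
      exists_adjoinRoot_equiv hcomp⟩
    · have h := tendsto_vev_wCurrent p hp b' hZ0' hlim' hc' s i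
      have h1 : ∀ a ∈ Finset.range p, (sheet p a Q - ofZeta p ℂ (shift p b b')) ^ s =
          sheet p a (Q' ^ s) := fun a _ => by
        rw [← hsheet]
        exact (map_pow (sheetHom p a) Q' s).symm
      rw [Finset.sum_congr rfl h1]
      exact h
    · simp only [hsheet]
    · rw [hcurve]
      refine Finset.prod_congr rfl fun a _ => ?_
      rw [hsheet, map_sub]
      ring
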